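/- **Setting.** Let $A\in\mathbb R^{m\times n}$, $b\in\mathbb R^m$, and let $\psi:\mathbb R^m\to\mathbb R\cup\{+\infty\}$, $\varphi:\mathbb R^n\to\mathbb R\cup\{+\infty\}$ be proper and lower semicontinuous. Put $f(x)=\psi(Ax-b)$ and $F=f+\varphi$, and assume: (i) there is a closed set $\Omega\supseteq\operatorname{dom}\varphi$ such that $\psi$ is (finite and) twice continuously differentiable on an open set containing $A(\Omega)-b$; (ii) $\varphi$ is convex, and continuous on $\operatorname{dom}\varphi$; (iii) $\inf_x F(x)>-\infty$. Norms are Euclidean (operator norms for matrices), $B_\varepsilon(x)$ is the closed ball, $[t]_+=\max\{0,t\}$. Let $$r(x)=x-\operatorname{prox}_\varphi(x-\nabla f(x)),\qquad \operatorname{prox}_\varphi(z)=\operatorname{argmin}_y\{\varphi(y)+\tfrac12\|y-z\|^2\},$$ and let $X^*$ be the set of strongly stationary points, i.e. of all $x\in\operatorname{dom}\varphi$ such that $0\in\partial F(x)$ (limiting subdifferential) and $\nabla^2\psi(Ax-b)\succeq0$. **Algorithm.** Parameters: $c_1\in(0,1)$, $c_2\in(c_1,1)$, $\sigma_1\in(0,1)$,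 $\sigma_2>1$, $\eta,\theta,\alpha\in(0,1)$, $a\ge1$, $0<\nu_{\min}\le\nu_0\le\overline\nu$, $0<\delta\le1$, $\tau\ge\delta$, $p_{\min}\in(0,\tfrac12)$, $\kappa>1+\delta$. Start with $x^0\in\operatorname{dom}\varphi$, $\overline r_0=\|r(x^0)\|$. For $k=0,1,2,\dots$ put $$\mu_k=\nu_k\overline r_k^{\,\delta},\quad \Lambda_k=a\,[-\lambda_{\min}(\nabla^2\psi(Ax^k-b))]_+,\quad G_k=\nabla^2 f(x^k)+\Lambda_kA^\top A+\mu_kI,$$ $$q_k(x)=f(x^k)+\nabla f(x^k)^\top(x-x^k)+\tfrac12(x-x^k)^\top\nabla^2f(x^k)(x-x^k)+\varphi(x),$$ let $\hat q_k$ be the same expression with $G_k$ in place of $\nabla^2f(x^k)$, and $R_k(x)=x-\operatorname{prox}_\varphi\big(x-\nabla f(x^k)-G_k(x-x^k)\big)$. Let $\hat x^k$ be any point with $$\|R_k(\hat x^k)\|\le\theta\min\{\|r(x^k)\|,\|r(x^k)\|^{1+\tau}\}\quad\text{and}\quad F(x^k)-\hat q_k(\hat x^k)\ge\tfrac{\alpha\mu_k}2\|\hat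 x^k-x^k\|^2 .$$ Let $d^k=\hat x^k-x^k$, $\mathrm{ared}_k=F(x^k)-F(\hat x^k)$, $\mathrm{pred}_k=F(x^k)-q_k(\hat x^k)$, $\rho_k=\mathrm{ared}_k/\mathrm{pred}_k$. * If $\mathrm{pred}_k\le p_{\min}(1-\theta)\|d^k\|\min\{\|r(x^k)\|,\|r(x^k)\|^\kappa\}$ or $\rho_k\le c_1$, set $x^{k+1}=x^k$, $\nu_{k+1}=\sigma_2\nu_k$. * Otherwise set $x^{k+1}=\hat x^k$, with $\nu_{k+1}=\min\{\nu_k,\overline\nu\}$ if $\rho_k\le c_2$ and $\nu_{k+1}=\min\{\max\{\sigma_1\nu_k,\nu_{\min}\},\overline\nu\}$ if $\rho_k>c_2$. * If $\|r(x^{k+1})\|\le\eta\,\overline r_k$, set $\overline r_{k+1}=\|r(x^{k+1})\|$; otherwise $\overline r_{k+1}=\overline r_k$. Let $\mathcal K=\{0\}\cup\{k+1:\ k\ge 0,\ \|r(x^{k+1})\|\le\eta\,\overline r_k\}$, and let $\{x^k\}$ be any infinite sequence generated in this way. **Local assumptions.** (a) $x^*\in X^*$ is an accumulation point of the subsequence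 $\{x^k\}_{k\in\mathcal K}$. There is $\varepsilon>0$ such that (b) for some $L_\psi>0$, $\|\nabla^2\psi(Ax-b)-\nabla^2\psi(Ay-b)\|\le L_\psi\|Ax-Ay\|$ for all $x,y\in B_\varepsilon(x^*)\cap\operatorname{dom}\varphi$; and (c) for some $\beta>0$ and some $q>\max\{\delta,1-\delta\}$, $\beta\operatorname{dist}(x,X^*)\le\|r(x)\|^q$ for all $x\in B_\varepsilon(x^*)\cap\operatorname{dom}\varphi$. **Corollary.** Suppose these assumptions hold and, in addition, $q>\frac1{1+\delta}$. Put $\rho=\min\{1+\tau,\delta+q\}$. Then $\rho>1$, $(1+\delta)q>1$, and: 1. $x^k\to x^*$; 2. $\|r(x^k)\|\to0$ at the rate $\rho$: there is $C>0$ such that $\|r(x^{k+1})\|\le C\|r(x^k)\|^{\rho}$ for all sufficiently large $k$; 3. $\operatorname{dist}(x^k,X^*)\to0$ at the rate $(1+\delta)q$: there is $C>0$ such that $\operatorname{dist}(x^{k+1},X^*)\le C\operatorname{dist}(x^k,X^*)^{(1+\delta)q}$ for all sufficiently large $k$. -/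

import Mathlib

open Filter Topology

noncomputable section

namespace ProxNewton

/-- Euclidean space `ℝⁿ`. -/
abbrev E (n : ℕ) : Type := EuclideanSpace ℝ (Fin n)

/-! ### Extended-valued functions -/

/-- The effective domain of an extended-valued function. -/
def dom {n : ℕ} (g : E n → EReal) : Set (E n) := {x | g x < ⊤}

/-- `g` takes values in `ℝ ∪ {+∞}`, is proper and lower semicontinuous. -/
structure IsProperLsc {n : ℕ} (g : E n → EReal) : Prop where
  ne_bot : ∀ x, g x ≠ ⊥
  dom_nonempty : (dom g).Nonempty
  lsc : LowerSemicontinuous g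

/-- Convexity of an extended-valued function: its epigraph is convex. -/
def IsConvex {n : ℕ} (g : E n → EReal) : Prop :=
  Convex ℝ {p : E n × ℝ | g p.1 ≤ (p.2 : EReal)}

/-- `v` is a regular (Fréchet) subgradient of `g` at `x`: `g x` is finite and
`g y ≥ g x + ⟪v, y - x⟫ + o(‖y - x‖)` as `y → x`. -/
def IsRegularSubgradient {n : ℕ} (g : E n → EReal) (x v : E n) : Prop :=
  g x ≠ ⊤ ∧ g x ≠ ⊥ ∧
    ∀ ε : ℝ, 0 < ε → ∀ᶠ y in 𝓝 x,
      g x + ((inner ℝ v (y - x) - ε * ‖y - x‖ : ℝ) : EReal) ≤ g y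

/-- The basic (limiting, Mordukhovich) subdifferential of `g` at `x`. -/
def limitingSubdifferential {n : ℕ} (g : E n → EReal) (x : E n) : Set (E n) :=
  {v | g x ≠ ⊤ ∧ g x ≠ ⊥ ∧ ∃ (y w : ℕ → E n),
    Tendsto y atTop (𝓝 x) ∧ Tendsto (fun j => g (y j)) atTop (𝓝 (g x)) ∧
    (∀ j, IsRegularSubgradient g (y j) (w j)) ∧ Tendsto w atTop (𝓝 v)}

/-- The proximity operator: a minimizer of `y ↦ g y + ‖y - x‖² / 2` (it exists and is unique when
`g` is proper, lower semicontinuous and convex). -/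
def prox {n : ℕ} (g : E n → EReal) (x : E n) : E n :=
  Classical.epsilon fun y => ∀ z,
    g y + ((1 / 2 * ‖y - x‖ ^ 2 : ℝ) : EReal) ≤ g z + ((1 / 2 * ‖z - x‖ ^ 2 : ℝ) : EReal)

/-- The Hessian of a real function, as an operator: the derivative of the gradient. -/
def hess {n : ℕ} (h : E n → ℝ) (x : E n) : E n →L[ℝ] E n := fderiv ℝ (gradient h) x

/-- The smallest eigenvalue of a symmetric operator. -/
def lambdaMin {n : ℕ} (T : E n →L[ℝ] E n) : ℝ :=
  sInf {t : ℝ | Module.End.HasEigenvalue (T : E n →ₗ[ℝ] E n) t}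

/-! ### The composite problem `min ψ (A x - b) + φ x` -/

/-- The data of the problem. -/
structure Problem (m n : ℕ) where
  A : Matrix (Fin m) (Fin n) ℝ
  b : E m
  ψ : E m → EReal
  φ : E n → EReal

namespace Problem

variable {m n : ℕ} (P : Problem m n)

/-- The matrix `A` as a linear operator between Euclidean spaces. -/
def linA : E n →L[ℝ] E m := (Matrix.toEuclideanLin P.A).toContinuousLinearMap

/-- The affine map `x ↦ A x - b`. -/
def aff (x : E n) : E m := P.linA x - P.b

/-- The real-valued version of `ψ`, meaningful where `ψ` is finite. -/
def ψr (y : E m) : ℝ := (P.ψ y).toReal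

/-- The real-valued version of `f x = ψ (A x - b)`, meaningful where it is finite, in particular on
`dom φ`. -/
def f (x : E n) : ℝ := P.ψr (P.aff x)

/-- The objective `F x = ψ (A x - b) + φ x`. -/
def F (x : E n) : EReal := P.ψ (P.aff x) + P.φ x

/-- The standing assumptions on the problem. -/
structure Standing : Prop where
  ψ_lsc : IsProperLsc P.ψ
  φ_lsc : IsProperLsc P.φ
  /-- `ψ` is (finite and) twice continuously differentiable on an open set containing `A Ω - b`,
  for some closed `Ω ⊇ dom φ`. -/
  ψ_smooth : ∃ (Ω : Set (E n)) (U : Set (E m)), IsClosed Ω ∧ dom P.φ ⊆ Ω ∧ IsOpen U ∧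
    P.aff '' Ω ⊆ U ∧ (∀ y ∈ U, P.ψ y ≠ ⊤) ∧ ContDiffOn ℝ 2 P.ψr U
  φ_convex : IsConvex P.φ
  φ_cont : ContinuousOn P.φ (dom P.φ)
  bounded_below : ⊥ < ⨅ x, P.F x

/-- The set `X*` of strongly stationary points. -/
def strongStat : Set (E n) :=
  {x | x ∈ dom P.φ ∧ 0 ∈ limitingSubdifferential P.F x ∧ (hess P.ψr (P.aff x)).IsPositive}

/-- The residual (prox-gradient) mapping `r`. -/
def r (x : E n) : E n := x - prox P.φ (x - gradient P.f x)

/-- `Λ = a [-λ_min (∇²ψ (A x - b))]₊`. -/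
def Lam (a : ℝ) (x : E n) : ℝ := a * max 0 (-lambdaMin (hess P.ψr (P.aff x)))

/-- `H = ∇²f x + Λ Aᵀ A`. -/
def H (a : ℝ) (x : E n) : E n →L[ℝ] E n :=
  hess P.f x + P.Lam a x • (ContinuousLinearMap.adjoint P.linA ∘L P.linA)

/-- `G = H + μ I`. -/
def G (a μ : ℝ) (x : E n) : E n →L[ℝ] E n := P.H a x + μ • ContinuousLinearMap.id ℝ (E n)

/-- The model `y ↦ f x + ⟪∇f x, y - x⟫ + ⟪y - x, B (y - x)⟫ / 2 + φ y` at `x`. -/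
def model (B : E n →L[ℝ] E n) (x y : E n) : EReal :=
  ((P.f x + inner ℝ (gradient P.f x) (y - x) + 1 / 2 * inner ℝ (y - x) (B (y - x)) : ℝ) : EReal)
    + P.φ y

/-- The unregularized model `q` at `x`. -/
def q (x y : E n) : EReal := P.model (hess P.f x) x y

/-- The regularized model `q̂` at `x`, with regularization parameter `μ`. -/
def qhat (a μ : ℝ) (x y : E n) : EReal := P.model (P.G a μ x) x y

/-- The residual `R` of the regularized subproblem at `x`. -/
def R (a μ : ℝ) (x y : E n) : E n :=
  y - prox P.φ (y - gradient P.f x - P.G a μ x (y - x))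

/-- Actual reduction (both values of `F` are finite for the points generated by the algorithm). -/
def ared (x y : E n) : ℝ := (P.F x - P.F y).toReal

/-- Predicted reduction (both values are finite for the points generated by the algorithm). -/
def pred (x y : E n) : ℝ := (P.F x - P.q x y).toReal

/-- The ratio of the actual to the predicted reduction. -/
def ratio (x y : E n) : ℝ := P.ared x y / P.pred x y

end Problem

/-! ### The algorithm -/

/-- The parameters of the algorithm. -/
structure Params where
  c₁ : ℝ
  c₂ : ℝ
  σ₁ : ℝ
  σ₂ : ℝ
  η : ℝ
  θ : ℝ
  α : ℝ
  a : ℝ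
  νmin : ℝ
  ν₀ : ℝ
  νbar : ℝ
  δ : ℝ
  τ : ℝ
  pmin : ℝ
  κ : ℝ
  c₁_mem : c₁ ∈ Set.Ioo (0 : ℝ) 1
  c₂_mem : c₂ ∈ Set.Ioo c₁ 1
  σ₁_mem : σ₁ ∈ Set.Ioo (0 : ℝ) 1
  one_lt_σ₂ : 1 < σ₂
  η_mem : η ∈ Set.Ioo (0 : ℝ) 1
  θ_mem : θ ∈ Set.Ioo (0 : ℝ) 1
  α_mem : α ∈ Set.Ioo (0 : ℝ) 1
  one_le_a : 1 ≤ a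
  νmin_pos : 0 < νmin
  νmin_le : νmin ≤ ν₀
  ν₀_le : ν₀ ≤ νbar
  δ_mem : δ ∈ Set.Ioc (0 : ℝ) 1
  δ_le_τ : δ ≤ τ
  pmin_mem : pmin ∈ Set.Ioo (0 : ℝ) (1 / 2)
  κ_gt : 1 + δ < κ

namespace Problem

variable {m n : ℕ} (P : Problem m n) (p : Params)

/-- `y` is an acceptable inexact solution of the regularized subproblem at `x` with regularization
parameter `μ`. The second condition forces `φ y < ⊤`. -/
def Inexact (μ : ℝ) (x y : E n) : Prop :=
  ‖P.R p.a μ x y‖ ≤ p.θ * min ‖P.r x‖ (‖P.r x‖ ^ (1 + p.τ)) ∧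
    ((p.α * μ / 2 * ‖y - x‖ ^ 2 : ℝ) : EReal) ≤ P.F x - P.qhat p.a μ x y

/-- The test for an unsuccessful iteration with current point `x` and candidate `y`. -/
def Unsuccessful (x y : E n) : Prop :=
  P.pred x y ≤ p.pmin * (1 - p.θ) * ‖y - x‖ * min ‖P.r x‖ (‖P.r x‖ ^ p.κ) ∨ P.ratio x y ≤ p.c₁

open Classical in
/-- The sequences `x` (iterates), `xhat` (inexact subproblem solutions), `ν`, `rbar` and `μ` are
generated by the regularized proximal Newton method. -/
structure IsRun (x xhat : ℕ → E n) (ν rbar μ : ℕ → ℝ) : Prop where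
  x_zero : x 0 ∈ dom P.φ
  ν_zero : ν 0 = p.ν₀
  rbar_zero : rbar 0 = ‖P.r (x 0)‖
  μ_eq : ∀ k, μ k = ν k * rbar k ^ p.δ
  inexact : ∀ k, P.Inexact p (μ k) (x k) (xhat k)
  x_succ : ∀ k, x (k + 1) = if P.Unsuccessful p (x k) (xhat k) then x k else xhat k
  ν_succ : ∀ k, ν (k + 1) =
    if P.Unsuccessful p (x k) (xhat k) then p.σ₂ * ν k
    else if P.ratio (x k) (xhat k) ≤ p.c₂ then min (ν k) p.νbar
    else min (max (p.σ₁ * ν k) p.νmin) p.νbar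
  rbar_succ : ∀ k, rbar (k + 1) =
    if ‖P.r (x (k + 1))‖ ≤ p.η * rbar k then ‖P.r (x (k + 1))‖ else rbar k

/-- The index set `𝒦`: `0`, and all `k + 1` for which the residual test succeeds in
iteration `k`. -/
def indexK (x : ℕ → E n) (rbar : ℕ → ℝ) : Set ℕ :=
  {0} ∪ {j | ∃ k, j = k + 1 ∧ ‖P.r (x (k + 1))‖ ≤ p.η * rbar k}

/-- The local assumptions at `xs`, for the subsequence of `x` indexed by `K` and with Hölder
exponent `q` in the error bound. -/
structure LocalAssumption (x : ℕ → E n) (K : Set ℕ) (xs : E n) (q : ℝ) : Prop where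
  xs_mem : xs ∈ P.strongStat
  /-- `xs` is an accumulation point of the subsequence indexed by `K`. -/
  accum : ∃ s : ℕ → ℕ, StrictMono s ∧ (∀ j, s j ∈ K) ∧ Tendsto (fun j => x (s j)) atTop (𝓝 xs)
  q_gt : max p.δ (1 - p.δ) < q
  /-- Local Lipschitz continuity of `∇²ψ` relative to `A (dom φ) - b`, and the local Hölderian
  error bound. -/
  lipschitz_errorBound : ∃ ε : ℝ, 0 < ε ∧
    (∃ L : ℝ, 0 < L ∧ ∀ y ∈ Metric.closedBall xs ε ∩ dom P.φ,
      ∀ z ∈ Metric.closedBall xs ε ∩ dom P.φ,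
        ‖hess P.ψr (P.aff y) - hess P.ψr (P.aff z)‖ ≤ L * ‖P.linA y - P.linA z‖) ∧
    (∃ β : ℝ, 0 < β ∧ ∀ y ∈ Metric.closedBall xs ε ∩ dom P.φ,
      β * Metric.infDist y P.strongStat ≤ ‖P.r y‖ ^ q)

end Problem

/-- The sequence `u` of nonnegative numbers converges to `0` at the rate (with Q-order at
least) `ω`. -/
def ConvergesAtRate (u : ℕ → ℝ) (ω : ℝ) : Prop :=
  Tendsto u atTop (𝓝 0) ∧ ∃ C : ℝ, 0 < C ∧ ∀ᶠ k in atTop, u (k + 1) ≤ C * u k ^ ω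

end ProxNewton

end

/-! Near `xs` a regularized step behaves like a Newton step for a strongly monotone inclusion. Write
r for the residual norm at x, D for twice the distance of x to X*, d for the step, and μ = ν r^δ.
Nonexpansiveness of the proximity operator gives r = O(D), and the error bound gives D = O(r^q).
Since ∇²ψ is Lipschitz and positive semidefinite at points of X*, the shift ΛAᵀA is O(D), while G ⪰
μI.

Monotonicity of the subgradients of φ, applied to the inexact solution and a point of X*, yields
μ‖d‖ = O(e + D² + μD), with e the subproblem residual. As τ ≥ δ and q > δ, every term is O(μD), so
‖d‖ = O(D) (`step_le_of_scalar`). Taylor expansion bounds the new residual by O(r^δ D) + r^(1+τ).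
Eliminating D gives O(r^ρ); eliminating r gives O(D^(1+δ)), and the error bound at the new point
raises this to the power q. The step is accepted because pred ≥ μ‖d‖²/2 dominates both |ared − pred|
= O(‖d‖³) and the threshold of order r^κ‖d‖ (`successful_of_scalar`). `Standing.exists_local_step`
collects all this.

Since ρ > 1, the new residual is at most ηr, so the next index is again in 𝒦, with reference
residual equal to the residual and ν ≤ ν̄. The argument repeats: residuals decay geometrically, the
steps are summable, and the iterates stay near `xs` (`IsRun.local_convergence`). If the reference
residual ever vanishes, the run freezes at `xs` (`IsRun.eventually_const`). -/

namespace ProxNewton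

open scoped RealInnerProductSpace

variable {m n : ℕ}

/-! ### Convex functions, subgradients and the proximity operator -/

lemma IsProperLsc.coe_toReal {g : E n → EReal} (hg : IsProperLsc g) {x : E n} (hx : x ∈ dom g) :
    ((g x).toReal : EReal) = g x :=
  EReal.coe_toReal (ne_of_lt hx) (hg.ne_bot x)

lemma IsProperLsc.convexOn_toReal {g : E n → EReal} (hg : IsProperLsc g) (hc : IsConvex g) :
    ConvexOn ℝ (dom g) fun x => (g x).toReal := by
  have key : ∀ x ∈ dom g, ∀ y ∈ dom g, ∀ a b : ℝ, 0 ≤ a → 0 ≤ b → a + b = 1 →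
      g (a • x + b • y) ≤ ((a * (g x).toReal + b * (g y).toReal : ℝ) : EReal) := by
    intro x hx y hy a b ha hb hab
    have h1 : (x, (g x).toReal) ∈ {p : E n × ℝ | g p.1 ≤ (p.2 : EReal)} :=
      (hg.coe_toReal hx).ge
    have h2 : (y, (g y).toReal) ∈ {p : E n × ℝ | g p.1 ≤ (p.2 : EReal)} :=
      (hg.coe_toReal hy).ge
    exact hc h1 h2 ha hb hab
  have hdom : ∀ x ∈ dom g, ∀ y ∈ dom g, ∀ a b : ℝ, 0 ≤ a → 0 ≤ b → a + b = 1 →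
      a • x + b • y ∈ dom g := fun x hx y hy a b ha hb hab =>
    (key x hx y hy a b ha hb hab).trans_lt (EReal.coe_lt_top _)
  refine ⟨fun x hx y hy a b ha hb hab => hdom x hx y hy a b ha hb hab, ?_⟩
  intro x hx y hy a b ha hb hab
  have h := key x hx y hy a b ha hb hab
  rw [← hg.coe_toReal (hdom x hx y hy a b ha hb hab)] at h
  exact_mod_cast h

/-- `v` is a subgradient of the convex function `g` at `x`. -/
def IsSubgradient (g : E n → EReal) (x v : E n) : Prop :=
  x ∈ dom g ∧ ∀ y ∈ dom g, (g x).toReal + ⟪v, y - x⟫ ≤ (g y).toReal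

lemma IsSubgradient.monotone {g : E n → EReal} {x y v w : E n} (hx : IsSubgradient g x v)
    (hy : IsSubgradient g y w) : 0 ≤ ⟪v - w, x - y⟫ := by
  have h1 := hx.2 y hy.1
  have h2 := hy.2 x hx.1
  have h3 : ⟪v, y - x⟫ = -⟪v, x - y⟫ := by rw [← inner_neg_right, neg_sub]
  rw [inner_sub_left]
  linarith

lemma nonneg_of_forall_small {c K : ℝ} (hK : 0 ≤ K)
    (h : ∀ t : ℝ, 0 < t → t ≤ 1 → 0 ≤ c + t * K) : 0 ≤ c := by
  by_contra hc
  push Not at hc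
  -- This value of t is at most 1 and satisfies tK ≤ -c/2, so c + tK ≤ c/2 < 0.
  have hp : 0 < -c / (2 * (K - c)) := by
    apply div_pos <;> linarith
  have h1 : -c / (2 * (K - c)) ≤ 1 := by
    rw [div_le_one (by linarith)]; linarith
  have h2 := h _ hp h1
  have h3 : -c / (2 * (K - c)) * K ≤ -c / 2 := by
    rw [div_mul_eq_mul_div, div_le_div_iff₀ (by linarith) (by norm_num)]
    nlinarith
  linarith

/-- The defining property of `prox g x`. -/
def IsProx (g : E n → EReal) (x y : E n) : Prop :=
  ∀ z, g y + ((1 / 2 * ‖y - x‖ ^ 2 : ℝ) : EReal) ≤ g z + ((1 / 2 * ‖z - x‖ ^ 2 : ℝ) : EReal)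

/-- The affine minorant given by `v` makes the objective coercive: outside the ball of radius 2(‖v‖
+ ‖x₀ - x‖) it is at least its value at `x₀`, so minimizing over the compact ball is enough. -/
lemma exists_isProx {g : E n → EReal} (hg : IsProperLsc g) {x₀ v : E n}
    (hv : IsSubgradient g x₀ v) (x : E n) : ∃ y, IsProx g x y := by
  have hlsc : LowerSemicontinuous fun y => g y + ((1 / 2 * ‖y - x‖ ^ 2 : ℝ) : EReal) := by
    refine LowerSemicontinuous.add' hg.lsc ?_ ?_
    · refine Continuous.lowerSemicontinuous ?_
      exact continuous_coe_real_ereal.comp (by fun_prop)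
    · intro y
      exact EReal.continuousAt_add (Or.inr (EReal.coe_ne_bot _)) (Or.inr (EReal.coe_ne_top _))
  have hx₀ : x₀ ∈ Metric.closedBall x (2 * (‖v‖ + ‖x₀ - x‖)) := by
    rw [Metric.mem_closedBall, dist_eq_norm]
    have := norm_nonneg v
    have := norm_nonneg (x₀ - x)
    linarith
  obtain ⟨y, -, hy⟩ := (hlsc.lowerSemicontinuousOn _).exists_isMinOn ⟨x₀, hx₀⟩
    (isCompact_closedBall x (2 * (‖v‖ + ‖x₀ - x‖)))
  refine ⟨y, fun z => ?_⟩
  by_cases hz : z ∈ Metric.closedBall x (2 * (‖v‖ + ‖x₀ - x‖))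
  · exact hy hz
  refine (hy hx₀).trans ?_
  by_cases hzd : z ∈ dom g
  · have h1 := hv.2 z hzd
    simp only
    rw [← hg.coe_toReal hzd, ← hg.coe_toReal hv.1]
    norm_cast
    rw [Metric.mem_closedBall, dist_eq_norm, not_le] at hz
    have h2 : -(‖v‖ * ‖z - x₀‖) ≤ ⟪v, z - x₀⟫ := by
      have := abs_real_inner_le_norm v (z - x₀)
      exact (abs_le.mp this).1
    have h3 : ‖z - x₀‖ ≤ ‖z - x‖ + ‖x₀ - x‖ := by
      have : z - x₀ = (z - x) - (x₀ - x) := by abel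
      rw [this]; exact norm_sub_le _ _
    have h4 := norm_nonneg v
    have h5 := norm_nonneg (x₀ - x)
    have h6 := mul_le_mul_of_nonneg_left h3 h4
    nlinarith
  · have : g z = ⊤ := by
      by_contra h
      exact hzd (lt_of_le_of_ne le_top h)
    rw [this, EReal.top_add_coe]
    exact le_top

/-- Compare `y` with (1 - t)y + tz, use convexity, divide by t and let t tend to 0. -/
lemma IsProx.isSubgradient {g : E n → EReal} (hg : IsProperLsc g) (hc : IsConvex g)
    {x y : E n} (h : IsProx g x y) : IsSubgradient g y (x - y) := by
  have hcv := hg.convexOn_toReal hc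
  have hyd : y ∈ dom g := by
    obtain ⟨x₀, hx₀⟩ := hg.dom_nonempty
    have h1 := h x₀
    rw [← hg.coe_toReal hx₀] at h1
    by_contra hy
    have : g y = ⊤ := by
      by_contra h'
      exact hy (lt_of_le_of_ne le_top h')
    rw [this, EReal.top_add_coe, top_le_iff] at h1
    norm_cast at h1
    exact EReal.coe_ne_top _ h1
  refine ⟨hyd, fun z hz => ?_⟩
  have key : 0 ≤ (g z).toReal - (g y).toReal - ⟪x - y, z - y⟫ := by
    refine nonneg_of_forall_small (K := 1 / 2 * ‖z - y‖ ^ 2) (by positivity) ?_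
    intro t ht ht1
    have hmem := hcv.1 hyd hz (by linarith : (0 : ℝ) ≤ 1 - t) ht.le (by ring)
    have hle := hcv.2 hyd hz (by linarith : (0 : ℝ) ≤ 1 - t) ht.le (by ring)
    have h1 := h ((1 - t) • y + t • z)
    rw [← hg.coe_toReal hyd, ← hg.coe_toReal hmem] at h1
    norm_cast at h1
    have h2 : ‖(1 - t) • y + t • z - x‖ ^ 2
        = ‖y - x‖ ^ 2 - 2 * t * ⟪x - y, z - y⟫ + t ^ 2 * ‖z - y‖ ^ 2 := by
      have : (1 - t) • y + t • z - x = (y - x) + t • (z - y) := by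
        module
      rw [this, norm_add_sq_real, norm_smul, inner_smul_right, mul_pow, Real.norm_eq_abs, sq_abs,
        ← neg_sub x y, inner_neg_left, norm_neg]
      ring
    rw [h2] at h1
    simp only [smul_eq_mul] at hle
    have h3 : 0 ≤ t * ((g z).toReal - (g y).toReal - ⟪x - y, z - y⟫
        + t * (1 / 2 * ‖z - y‖ ^ 2)) := by nlinarith
    exact nonneg_of_mul_nonneg_right h3 ht
  linarith

section Prox

variable {g : E n → EReal} (hg : IsProperLsc g) (hc : IsConvex g) {x₀ v : E n}
  (hv : IsSubgradient g x₀ v)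
include hg hc hv

/-- `Classical.epsilon` returns a minimizer once one exists; the subgradient `v` at `x₀` serves to
guarantee existence. -/
lemma isSubgradient_prox (x : E n) : IsSubgradient g (prox g x) (x - prox g x) :=
  IsProx.isSubgradient hg hc (Classical.epsilon_spec (exists_isProx hg hv x))

lemma prox_eq {x y : E n} (h : IsSubgradient g y (x - y)) : prox g x = y := by
  have h1 := (isSubgradient_prox hg hc hv x).monotone h
  have h2 : x - prox g x - (x - y) = -(prox g x - y) := by abel
  rw [h2, inner_neg_left, real_inner_self_eq_norm_sq] at h1
  have h3 : ‖prox g x - y‖ = 0 := by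
    have := sq_nonneg ‖prox g x - y‖
    exact pow_eq_zero_iff two_ne_zero |>.mp (by linarith)
  exact sub_eq_zero.mp (norm_eq_zero.mp h3)

/-- Monotonicity gives firm nonexpansiveness; Cauchy–Schwarz then finishes. -/
lemma norm_prox_sub_prox_le (x y : E n) : ‖prox g x - prox g y‖ ≤ ‖x - y‖ := by
  have h1 := (isSubgradient_prox hg hc hv x).monotone (isSubgradient_prox hg hc hv y)
  have h2 : x - prox g x - (y - prox g y) = (x - y) - (prox g x - prox g y) := by abel
  rw [h2, inner_sub_left, real_inner_self_eq_norm_sq] at h1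
  have h3 := real_inner_le_norm (x - y) (prox g x - prox g y)
  by_contra hlt
  push Not at hlt
  have h4 := norm_nonneg (x - y)
  nlinarith

end Prox

/-! ### Gradients and Hessians -/

lemma hasGradientAt_of_contDiffAt {h : E n → ℝ} {y : E n} (hh : ContDiffAt ℝ 2 h y) :
    HasGradientAt h (gradient h y) y :=
  (hh.differentiableAt (by norm_num)).hasGradientAt

lemma hasFDerivAt_fderiv_of_contDiffAt {h : E n → ℝ} {y : E n} (hh : ContDiffAt ℝ 2 h y) :
    HasFDerivAt (fderiv ℝ h) (fderiv ℝ (fderiv ℝ h) y) y :=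
  ((hh.fderiv_right (m := 1) (by norm_num)).differentiableAt (by norm_num)).hasFDerivAt

lemma hasFDerivAt_gradient {h : E n → ℝ} {y : E n} (hh : ContDiffAt ℝ 2 h y) :
    HasFDerivAt (gradient h) (hess h y) y := by
  have h1 := hasFDerivAt_fderiv_of_contDiffAt hh
  have h2 : DifferentiableAt ℝ (gradient h) y :=
    (InnerProductSpace.toDual ℝ (E n)).symm.differentiableAt.comp y h1.differentiableAt
  exact h2.hasFDerivAt

/-- Links `hess`, the derivative of the gradient, to the second Fréchet derivative, whose symmetry
is available for C² functions. -/
lemma inner_hess {h : E n → ℝ} {y : E n} (hh : ContDiffAt ℝ 2 h y) (u v : E n) :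
    ⟪hess h y u, v⟫ = fderiv ℝ (fderiv ℝ h) y u v := by
  have h1 := hasFDerivAt_fderiv_of_contDiffAt hh
  have h2 : ∀ z, ⟪gradient h z, v⟫ = fderiv ℝ h z v := fun z => by
    simp [gradient]
  have h3 : HasFDerivAt (fun z => ⟪gradient h z, v⟫)
      ((innerSL ℝ v) ∘L hess h y) y := by
    have := (innerSL ℝ v).hasFDerivAt.comp y (hasFDerivAt_gradient hh)
    refine this.congr_of_eventuallyEq (Eventually.of_forall fun z => ?_)
    simp
  have h4 : HasFDerivAt (fun z => fderiv ℝ h z v)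
      ((ContinuousLinearMap.apply ℝ ℝ v) ∘L fderiv ℝ (fderiv ℝ h) y) y :=
    (ContinuousLinearMap.apply ℝ ℝ v).hasFDerivAt.comp y h1
  simp only [h2] at h3
  have h5 := congrArg (fun T => T u) (h3.unique h4)
  simpa [real_inner_comm] using h5

lemma hess_isSymmetric {h : E n → ℝ} {y : E n} (hh : ContDiffAt ℝ 2 h y) :
    (hess h y : E n →ₗ[ℝ] E n).IsSymmetric := by
  intro u v
  have h1 : IsSymmSndFDerivAt ℝ h y := hh.isSymmSndFDerivAt (by simp)
  have h2 := h1 u v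
  rw [ContinuousLinearMap.coe_coe, inner_hess hh, real_inner_comm, inner_hess hh]
  exact h2

/-! ### The smallest eigenvalue -/

lemma bddBelow_eigenvalues (T : E n →L[ℝ] E n) :
    BddBelow {t : ℝ | Module.End.HasEigenvalue (T : E n →ₗ[ℝ] E n) t} := by
  exact (Module.End.finite_hasEigenvalue (T : E n →ₗ[ℝ] E n)).bddBelow

/-- Expand in an orthonormal eigenbasis; every eigenvalue is at least `lambdaMin T`. -/
lemma lambdaMin_le_inner {T : E n →L[ℝ] E n} (hT : (T : E n →ₗ[ℝ] E n).IsSymmetric) (v : E n) :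
    lambdaMin T * ‖v‖ ^ 2 ≤ ⟪T v, v⟫ := by
  have hdiag : ∀ i, lambdaMin T ≤ hT.eigenvalues rfl i := fun i =>
    csInf_le (bddBelow_eigenvalues T) (hT.hasEigenvalue_eigenvalues rfl i)
  have h1 := (hT.eigenvectorBasis rfl).sum_inner_mul_inner (T v) v
  have h2 := (hT.eigenvectorBasis rfl).sum_inner_mul_inner v v
  rw [← h1, ← real_inner_self_eq_norm_sq, ← h2, Finset.mul_sum]
  refine Finset.sum_le_sum fun i _ => ?_
  have h3 : ⟪T v, hT.eigenvectorBasis rfl i⟫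
      = hT.eigenvalues rfl i * ⟪v, hT.eigenvectorBasis rfl i⟫ := by
    have := hT v (hT.eigenvectorBasis rfl i)
    rw [hT.apply_eigenvectorBasis, inner_smul_right] at this
    simpa using this
  rw [h3, real_inner_comm _ v, mul_assoc]
  exact mul_le_mul_of_nonneg_right (hdiag i) (mul_self_nonneg _)

lemma neg_le_lambdaMin {T S : E n →L[ℝ] E n} (hS : S.IsPositive) {c : ℝ} (hc : ‖T - S‖ ≤ c) :
    -c ≤ lambdaMin T := by
  have hc0 : 0 ≤ c := (norm_nonneg _).trans hc
  rcases Set.eq_empty_or_nonempty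
    {t : ℝ | Module.End.HasEigenvalue (T : E n →ₗ[ℝ] E n) t} with he | hne
  -- There may be no real eigenvalue, since `T` need not be symmetric and n may be 0; the infimum is
  -- then 0 by convention.
  · rw [lambdaMin, he, Real.sInf_empty]; linarith
  · refine le_csInf hne fun t ht => ?_
    obtain ⟨v, hv⟩ := Module.End.HasEigenvalue.exists_hasEigenvector ht
    have h1 : T v = t • v := hv.apply_eq_smul
    have h2 : ⟪T v, v⟫ = t * ‖v‖ ^ 2 := by
      rw [h1, real_inner_smul_left, real_inner_self_eq_norm_sq]
    have h3 : 0 ≤ ⟪S v, v⟫ := hS.inner_nonneg_left v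
    have h4 : ⟪T v, v⟫ = ⟪S v, v⟫ + ⟪(T - S) v, v⟫ := by
      rw [← inner_add_left]; simp
    have h5 : |⟪(T - S) v, v⟫| ≤ c * ‖v‖ ^ 2 := by
      refine (abs_real_inner_le_norm _ _).trans ?_
      have := (T - S).le_of_opNorm_le hc v
      calc ‖(T - S) v‖ * ‖v‖ ≤ (c * ‖v‖) * ‖v‖ := by gcongr
        _ = c * ‖v‖ ^ 2 := by ring
    have h6 : 0 < ‖v‖ ^ 2 := by
      have := norm_pos_iff.mpr hv.2
      positivity
    have h7 := (abs_le.mp h5).1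
    nlinarith

/-! ### Taylor estimates -/

/-- Mean value inequality on the segment for z ↦ ∇h(z) - ∇²h(x)z, whose derivative there is at most
L‖y - x‖. The sharp factor 1/2 is not needed. -/
lemma norm_gradient_sub_le {h : E n → ℝ} {S : Set (E n)} (hS : Convex ℝ S)
    (hd : ∀ z ∈ S, ContDiffAt ℝ 2 h z) {L : ℝ} (hL0 : 0 ≤ L)
    (hL : ∀ y ∈ S, ∀ z ∈ S, ‖hess h y - hess h z‖ ≤ L * ‖y - z‖) {x y : E n}
    (hx : x ∈ S) (hy : y ∈ S) :
    ‖gradient h y - gradient h x - hess h x (y - x)‖ ≤ L * ‖y - x‖ ^ 2 := by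
  have hseg : segment ℝ x y ⊆ S := hS.segment_subset hx hy
  have h1 := (convex_segment x y).norm_image_sub_le_of_norm_hasFDerivWithin_le
    (f := fun z => gradient h z - hess h x z) (f' := fun z => hess h z - hess h x)
    (C := L * ‖y - x‖) (fun z hz => ((hasFDerivAt_gradient (hd z (hseg hz))).sub
      (hess h x).hasFDerivAt).hasFDerivWithinAt) (fun z hz => ?_)
    (left_mem_segment ℝ x y) (right_mem_segment ℝ x y)
  · have h2 : gradient h y - gradient h x - hess h x (y - x)
        = gradient h y - hess h x y - (gradient h x - hess h x x) := by
      rw [map_sub]; abel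
    rw [h2]
    calc _ ≤ L * ‖y - x‖ * ‖y - x‖ := h1
      _ = _ := by ring
  · refine (hL z (hseg hz) x hx).trans ?_
    gcongr
    exact norm_sub_le_of_mem_segment hz

/-- The gradient of the second-order remainder is the remainder bounded in `norm_gradient_sub_le`,
so the mean value inequality applies once more. -/
lemma abs_taylor_le {h : E n → ℝ} {S : Set (E n)} (hS : Convex ℝ S)
    (hd : ∀ z ∈ S, ContDiffAt ℝ 2 h z) {L : ℝ} (hL0 : 0 ≤ L)
    (hL : ∀ y ∈ S, ∀ z ∈ S, ‖hess h y - hess h z‖ ≤ L * ‖y - z‖) {x y : E n}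
    (hx : x ∈ S) (hy : y ∈ S) :
    |h y - h x - ⟪gradient h x, y - x⟫ - 1 / 2 * ⟪y - x, hess h x (y - x)⟫|
      ≤ L * ‖y - x‖ ^ 3 := by
  have hseg : segment ℝ x y ⊆ S := hS.segment_subset hx hy
  have hderiv : ∀ z ∈ S, HasFDerivAt
      (fun z => h z - ⟪gradient h x, z - x⟫ - 1 / 2 * ⟪z - x, hess h x (z - x)⟫)
      (innerSL ℝ (gradient h z - gradient h x - hess h x (z - x))) z := by
    intro z hz
    have a1 := (hasGradientAt_of_contDiffAt (hd z hz)).hasFDerivAt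
    have a0 : HasFDerivAt (fun z : E n => z - x) (ContinuousLinearMap.id ℝ (E n)) z :=
      (hasFDerivAt_id z).sub_const x
    have a2 := (hasFDerivAt_const (gradient h x) z).inner ℝ a0
    have a3 := a0.inner ℝ ((hess h x).hasFDerivAt.comp z a0)
    refine ((a1.sub a2).sub (a3.const_mul (1 / 2))).congr_fderiv ?_
    ext u
    have hs : ⟪z - x, hess h x u⟫ = ⟪hess h x (z - x), u⟫ :=
      (hess_isSymmetric (hd x hx) (z - x) u).symm
    have hs' : ⟪u, hess h x (z - x)⟫ = ⟪hess h x (z - x), u⟫ := real_inner_comm _ _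
    simp [hs, hs', inner_sub_left, -map_sub]
    ring
  have h1 := (convex_segment x y).norm_image_sub_le_of_norm_hasFDerivWithin_le
    (C := L * ‖y - x‖ ^ 2) (fun z hz => (hderiv z (hseg hz)).hasFDerivWithinAt) (fun z hz => ?_)
    (left_mem_segment ℝ x y) (right_mem_segment ℝ x y)
  · simp only [sub_self, inner_zero_right, map_zero, mul_zero, sub_zero, Real.norm_eq_abs] at h1
    rw [show h y - h x - ⟪gradient h x, y - x⟫ - 1 / 2 * ⟪y - x, hess h x (y - x)⟫
      = h y - ⟪gradient h x, y - x⟫ - 1 / 2 * ⟪y - x, hess h x (y - x)⟫ - h x by ring]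
    calc _ ≤ L * ‖y - x‖ ^ 2 * ‖y - x‖ := h1
      _ = _ := by ring
  · rw [innerSL_apply_norm]
    refine (norm_gradient_sub_le hS hd hL0 hL hx (hseg hz)).trans ?_
    gcongr
    exact norm_sub_le_of_mem_segment hz

namespace Problem

variable {P : Problem m n}

/-! ### The composite problem on the domain of `φ` -/

lemma hasFDerivAt_aff (P : Problem m n) (x : E n) : HasFDerivAt P.aff P.linA x :=
  P.linA.hasFDerivAt.sub_const P.b

lemma inner_H_eq {a : ℝ} {x : E n} (v : E n) :
    ⟪v, P.H a x v⟫ = ⟪v, hess P.f x v⟫ + P.Lam a x * ‖P.linA v‖ ^ 2 := by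
  rw [H, add_apply, inner_add_right, smul_apply,
    inner_smul_right, ContinuousLinearMap.comp_apply, ContinuousLinearMap.adjoint_inner_right,
    real_inner_self_eq_norm_sq]

section Standing

variable (hP : P.Standing)
include hP

lemma Standing.contDiffAt_ψr {x : E n} (hx : x ∈ dom P.φ) : ContDiffAt ℝ 2 P.ψr (P.aff x) := by
  obtain ⟨Ω, U, -, hΩ, hU, hsub, -, hC⟩ := hP.ψ_smooth
  exact hC.contDiffAt (hU.mem_nhds (hsub ⟨x, hΩ hx, rfl⟩))

lemma Standing.ψ_ne_top {x : E n} (hx : x ∈ dom P.φ) : P.ψ (P.aff x) ≠ ⊤ := by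
  obtain ⟨Ω, U, -, hΩ, -, hsub, ht, -⟩ := hP.ψ_smooth
  exact ht _ (hsub ⟨x, hΩ hx, rfl⟩)

lemma Standing.contDiffAt_f {x : E n} (hx : x ∈ dom P.φ) : ContDiffAt ℝ 2 P.f x := by
  have h1 : ContDiffAt ℝ 2 P.aff x := by
    unfold aff
    exact (P.linA.contDiff.sub contDiff_const).contDiffAt
  exact (hP.contDiffAt_ψr hx).comp x h1

lemma Standing.hess_f {x : E n} (hx : x ∈ dom P.φ) :
    hess P.f x = (ContinuousLinearMap.adjoint P.linA) ∘L hess P.ψr (P.aff x) ∘L P.linA := by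
  -- Smoothness of ψ holds on an open set, so the gradient formula is valid on a full neighbourhood
  -- of `x`, even where φ = +∞, and may be differentiated.
  have hev : ∀ᶠ z in 𝓝 x, ContDiffAt ℝ 2 P.ψr (P.aff z) :=
    (hasFDerivAt_aff P x).continuousAt.eventually
      ((hP.contDiffAt_ψr hx).eventually (by simp))
  have hgrad : gradient P.f =ᶠ[𝓝 x]
      fun z => ContinuousLinearMap.adjoint P.linA (gradient P.ψr (P.aff z)) := by
    filter_upwards [hev] with z hz
    have h1 := (hasGradientAt_of_contDiffAt hz).hasFDerivAt.comp z (hasFDerivAt_aff P z)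
    refine HasGradientAt.gradient (hasGradientAt_iff_hasFDerivAt.mpr (h1.congr_fderiv ?_))
    ext u
    simp [ContinuousLinearMap.adjoint_inner_left]
  have h2 : HasFDerivAt (fun z => ContinuousLinearMap.adjoint P.linA (gradient P.ψr (P.aff z)))
      ((ContinuousLinearMap.adjoint P.linA) ∘L hess P.ψr (P.aff x) ∘L P.linA) x :=
    (ContinuousLinearMap.adjoint P.linA).hasFDerivAt.comp x
      ((hasFDerivAt_gradient (hP.contDiffAt_ψr hx)).comp x (hasFDerivAt_aff P x))
  exact (h2.congr_of_eventuallyEq hgrad).fderiv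

lemma Standing.F_eq {x : E n} (hx : x ∈ dom P.φ) :
    P.F x = ((P.f x + (P.φ x).toReal : ℝ) : EReal) := by
  rw [EReal.coe_add, hP.φ_lsc.coe_toReal hx, f, ψr,
    EReal.coe_toReal (hP.ψ_ne_top hx) (hP.ψ_lsc.ne_bot _), F]

lemma Standing.mem_dom_of_F_ne_top {x : E n} (hx : P.F x ≠ ⊤) : x ∈ dom P.φ := by
  refine lt_of_le_of_ne (le_top : P.φ x ≤ ⊤) fun h => hx ?_
  rw [F, h, EReal.add_top_of_ne_bot (hP.ψ_lsc.ne_bot _)]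

lemma Standing.model_eq (B : E n →L[ℝ] E n) (x : E n) {y : E n} (hy : y ∈ dom P.φ) :
    P.model B x y = ((P.f x + ⟪gradient P.f x, y - x⟫ + 1 / 2 * ⟪y - x, B (y - x)⟫
      + (P.φ y).toReal : ℝ) : EReal) := by
  rw [model, ← hP.φ_lsc.coe_toReal hy, EReal.toReal_coe, ← EReal.coe_add]

lemma Standing.ared_eq {x y : E n} (hx : x ∈ dom P.φ) (hy : y ∈ dom P.φ) :
    P.ared x y = P.f x + (P.φ x).toReal - (P.f y + (P.φ y).toReal) := by
  rw [ared, hP.F_eq hx, hP.F_eq hy, ← EReal.coe_sub, EReal.toReal_coe]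

lemma Standing.pred_eq {x y : E n} (hx : x ∈ dom P.φ) (hy : y ∈ dom P.φ) :
    P.pred x y = (P.φ x).toReal - ⟪gradient P.f x, y - x⟫
      - 1 / 2 * ⟪y - x, hess P.f x (y - x)⟫ - (P.φ y).toReal := by
  rw [pred, hP.F_eq hx, q, hP.model_eq _ _ hy, ← EReal.coe_sub, EReal.toReal_coe]
  ring

lemma Standing.mem_dom_of_inexact {p : Params} {μ : ℝ} {x y : E n} (hx : x ∈ dom P.φ)
    (h : P.Inexact p μ x y) : y ∈ dom P.φ := by
  by_contra hy
  have ht : P.φ y = ⊤ := by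
    by_contra h'
    exact hy (lt_of_le_of_ne le_top h')
  have h2 := h.2
  rw [qhat, model, ht, EReal.coe_add_top, hP.F_eq hx, EReal.sub_top] at h2
  exact EReal.coe_ne_bot _ (le_bot_iff.mp h2)

/-- H = Aᵀ(∇²ψ + ΛI)A, and a ≥ 1 makes Λ at least -λ_min(∇²ψ). -/
lemma Standing.inner_H_nonneg {a : ℝ} (ha : 1 ≤ a) {x : E n} (hx : x ∈ dom P.φ) (v : E n) :
    0 ≤ ⟪v, P.H a x v⟫ := by
  rw [inner_H_eq, hP.hess_f hx, ContinuousLinearMap.comp_apply,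
    ContinuousLinearMap.adjoint_inner_right, ContinuousLinearMap.comp_apply, real_inner_comm]
  have h1 := lambdaMin_le_inner (hess_isSymmetric (hP.contDiffAt_ψr hx)) (P.linA v)
  have h2 : -lambdaMin (hess P.ψr (P.aff x)) ≤ P.Lam a x := by
    unfold Lam
    have h3 := le_max_left 0 (-lambdaMin (hess P.ψr (P.aff x)))
    have h4 := le_max_right 0 (-lambdaMin (hess P.ψr (P.aff x)))
    nlinarith
  have h5 := sq_nonneg ‖P.linA v‖
  nlinarith

/-- The sufficient decrease condition bounds the predicted reduction from below. -/
lemma Standing.le_pred {p : Params} {μ : ℝ} {x y : E n} (hx : x ∈ dom P.φ)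
    (h : P.Inexact p μ x y) : (1 + p.α) * μ / 2 * ‖y - x‖ ^ 2 ≤ P.pred x y := by
  have hy := hP.mem_dom_of_inexact hx h
  have h2 := h.2
  rw [qhat, hP.model_eq _ _ hy, hP.F_eq hx, ← EReal.coe_sub, EReal.coe_le_coe_iff, G,
    add_apply, inner_add_right, inner_H_eq,
    smul_apply, inner_smul_right, ContinuousLinearMap.id_apply,
    real_inner_self_eq_norm_sq] at h2
  rw [hP.pred_eq hx hy]
  -- The regularized model exceeds q by ½Λ‖Ad‖² + ½μ‖d‖²; the first term is dropped, the second
  -- turns α into 1 + α.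
  have h3 : 0 ≤ P.Lam p.a x * ‖P.linA (y - x)‖ ^ 2 :=
    mul_nonneg (mul_nonneg (by linarith [p.one_le_a]) (le_max_left _ _)) (sq_nonneg _)
  linarith

/-- Stationarity in the limiting sense yields the variational inequality for `φ`. -/
lemma Standing.isSubgradient_of_regular {x w : E n} (h : IsRegularSubgradient P.F x w) :
    IsSubgradient P.φ x (w - gradient P.f x) := by
  obtain ⟨ht, -, h⟩ := h
  have hx := hP.mem_dom_of_F_ne_top ht
  have hcv := hP.φ_lsc.convexOn_toReal hP.φ_convex
  refine ⟨hx, fun z hz => ?_⟩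
  have hgrad := (hasGradientAt_of_contDiffAt (hP.contDiffAt_f hx)).hasFDerivAt
  -- The differentiability of f and the regular subgradient inequality each cost ε‖z - x‖, whence
  -- the factor 2. It suffices to use one small t on the segment towards `z`, since convexity lets
  -- the inequality be divided by t.
  suffices hs : ∀ ε : ℝ, 0 < ε →
      (P.φ x).toReal + ⟪w - gradient P.f x, z - x⟫ ≤ (P.φ z).toReal + ε * (2 * ‖z - x‖) by
    by_contra hlt
    push Not at hlt
    have h0 : 0 ≤ ‖z - x‖ := norm_nonneg _
    have := hs (((P.φ x).toReal + ⟪w - gradient P.f x, z - x⟫ - (P.φ z).toReal)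
      / (2 * ‖z - x‖ + 1)) (by apply div_pos <;> linarith)
    rw [div_mul_eq_mul_div, ← sub_le_iff_le_add', le_div_iff₀ (by linarith)] at this
    nlinarith
  intro ε hε
  have h1 := (hgrad.isLittleO.def hε).and (h ε hε)
  have hpath : Tendsto (fun t : ℝ => x + t • (z - x)) (𝓝[>] 0) (𝓝 x) := by
    have : ContinuousAt (fun t : ℝ => x + t • (z - x)) 0 := by fun_prop
    have h' := this.tendsto
    simp only [zero_smul, add_zero] at h'
    exact h'.mono_left nhdsWithin_le_nhds
  obtain ⟨t, ⟨hta, htb⟩, ht0, ht1⟩ := ((hpath.eventually h1).and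
    (Ioc_mem_nhdsGT (zero_lt_one' ℝ))).exists
  have hconv : x + t • (z - x) = (1 - t) • x + t • z := by module
  have hmem := hcv.1 hx hz (by linarith : (0 : ℝ) ≤ 1 - t) ht0.le (by ring)
  have hle := hcv.2 hx hz (by linarith : (0 : ℝ) ≤ 1 - t) ht0.le (by ring)
  rw [← hconv] at hmem hle
  rw [hP.F_eq hx, hP.F_eq hmem, ← EReal.coe_add, EReal.coe_le_coe_iff] at htb
  simp only [add_sub_cancel_left, inner_smul_right, norm_smul, Real.norm_eq_abs, abs_of_pos ht0,
    InnerProductSpace.toDual_apply_apply, smul_eq_mul] at hta htb hle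
  have h3 := (abs_le.mp hta).2
  rw [inner_sub_left]
  have h4 : 0 ≤ t * ((P.φ z).toReal + ε * (2 * ‖z - x‖) - (P.φ x).toReal
      - (⟪w, z - x⟫ - ⟪gradient P.f x, z - x⟫)) := by nlinarith
  have := nonneg_of_mul_nonneg_right h4 ht0
  linarith

/-- Pass to the limit in the subgradient inequality at the approximating points, by continuity of φ
on its domain and of ∇f. -/
lemma Standing.isSubgradient_of_limiting {x : E n}
    (h : 0 ∈ limitingSubdifferential P.F x) : IsSubgradient P.φ x (-gradient P.f x) := by
  obtain ⟨ht, -, y, w, hy, -, hreg, hw⟩ := h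
  have hx := hP.mem_dom_of_F_ne_top ht
  refine ⟨hx, fun z hz => ?_⟩
  have hsub := fun j => hP.isSubgradient_of_regular (hreg j)
  have hyD : Tendsto y atTop (𝓝[dom P.φ] x) :=
    tendsto_nhdsWithin_iff.mpr ⟨hy, Eventually.of_forall fun j => (hsub j).1⟩
  have h1 : Tendsto (fun j => (P.φ (y j)).toReal) atTop (𝓝 (P.φ x).toReal) :=
    (EReal.tendsto_toReal hx.ne (hP.φ_lsc.ne_bot x)).comp ((hP.φ_cont x hx).tendsto.comp hyD)
  have h2 : Tendsto (fun j => gradient P.f (y j)) atTop (𝓝 (gradient P.f x)) :=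
    (hasFDerivAt_gradient (hP.contDiffAt_f hx)).continuousAt.tendsto.comp hy
  have h3 := h1.add ((hw.sub h2).inner (tendsto_const_nhds (x := z) |>.sub hy))
  rw [zero_sub] at h3
  exact le_of_tendsto h3 (Eventually.of_forall fun j => (hsub j).2 z hz)

end Standing

/-! ### Uniform estimates near a strongly stationary point -/

/-- Uniform bounds with constant `M` on the part of `dom φ` within distance `ε` of `xs`. -/
structure LocalBounds (P : Problem m n) (a : ℝ) (xs : E n) (ε M : ℝ) : Prop where
  M_nonneg : 0 ≤ M
  grad_taylor : ∀ x ∈ Metric.closedBall xs ε ∩ dom P.φ, ∀ y ∈ Metric.closedBall xs ε ∩ dom P.φ,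
    ‖gradient P.f y - gradient P.f x - hess P.f x (y - x)‖ ≤ M * ‖y - x‖ ^ 2
  taylor : ∀ x ∈ Metric.closedBall xs ε ∩ dom P.φ, ∀ y ∈ Metric.closedBall xs ε ∩ dom P.φ,
    |P.f y - P.f x - ⟪gradient P.f x, y - x⟫ - 1 / 2 * ⟪y - x, hess P.f x (y - x)⟫|
      ≤ M * ‖y - x‖ ^ 3
  grad_lipschitz : ∀ x ∈ Metric.closedBall xs ε ∩ dom P.φ,
    ∀ y ∈ Metric.closedBall xs ε ∩ dom P.φ, ‖gradient P.f y - gradient P.f x‖ ≤ M * ‖y - x‖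
  hess_bound : ∀ x ∈ Metric.closedBall xs ε ∩ dom P.φ, ‖hess P.f x‖ ≤ M
  lam_bound : ∀ x ∈ Metric.closedBall xs ε ∩ dom P.φ,
    ∀ z ∈ Metric.closedBall xs ε ∩ P.strongStat, P.Lam a x * ‖P.linA‖ ^ 2 ≤ M * ‖x - z‖

lemma Lam_nonneg {a : ℝ} (ha : 1 ≤ a) (x : E n) : 0 ≤ P.Lam a x :=
  mul_nonneg (by linarith) (le_max_left _ _)

lemma norm_adjoint_comp_linA_le (P : Problem m n) (v : E n) :
    ‖(ContinuousLinearMap.adjoint P.linA ∘L P.linA) v‖ ≤ ‖P.linA‖ ^ 2 * ‖v‖ := by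
  rw [ContinuousLinearMap.comp_apply]
  refine ((ContinuousLinearMap.adjoint P.linA).le_opNorm _).trans ?_
  rw [LinearIsometryEquiv.norm_map, pow_two, mul_assoc]
  gcongr
  exact P.linA.le_opNorm v

lemma norm_G_sub_hess_le {a μ : ℝ} (ha : 1 ≤ a) (hμ : 0 ≤ μ) (x v : E n) :
    ‖P.G a μ x v - hess P.f x v‖ ≤ (P.Lam a x * ‖P.linA‖ ^ 2 + μ) * ‖v‖ := by
  have h1 : P.G a μ x v - hess P.f x v
      = P.Lam a x • (ContinuousLinearMap.adjoint P.linA ∘L P.linA) v + μ • v := by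
    simp only [G, H, add_apply, smul_apply, ContinuousLinearMap.id_apply]
    abel
  rw [h1]
  refine (norm_add_le _ _).trans ?_
  rw [norm_smul, norm_smul, Real.norm_of_nonneg hμ, Real.norm_of_nonneg (Lam_nonneg ha x), add_mul,
    mul_assoc]
  gcongr
  · exact Lam_nonneg ha x
  · exact norm_adjoint_comp_linA_le P v

lemma inner_G_eq (a μ : ℝ) (x v : E n) :
    ⟪v, P.G a μ x v⟫ = ⟪v, P.H a x v⟫ + μ * ‖v‖ ^ 2 := by
  rw [G, add_apply, inner_add_right, smul_apply, inner_smul_right, ContinuousLinearMap.id_apply,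
    real_inner_self_eq_norm_sq]

section Standing

variable (hP : P.Standing)
include hP

/-- ∇²f = Aᵀ∇²ψA is Lipschitz with constant L‖A‖³ on the convex set `S`, which gives the Taylor
bounds. At z in X* the Hessian of ψ is positive, so λ_min at x is at least -L‖A‖‖x - z‖; this makes
Λ small. -/
lemma Standing.exists_localBounds {a : ℝ} (ha : 1 ≤ a) {xs : E n} (hxs : xs ∈ P.strongStat)
    {ε L : ℝ} (hε : 0 < ε) (hε1 : ε ≤ 1) (hL : 0 < L)
    (hlip : ∀ y ∈ Metric.closedBall xs ε ∩ dom P.φ, ∀ z ∈ Metric.closedBall xs ε ∩ dom P.φ,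
      ‖hess P.ψr (P.aff y) - hess P.ψr (P.aff z)‖ ≤ L * ‖P.linA y - P.linA z‖) :
    ∃ M, P.LocalBounds a xs ε M := by
  set S := Metric.closedBall xs ε ∩ dom P.φ with hS
  have hconv : Convex ℝ S :=
    (convex_closedBall xs ε).inter (hP.φ_lsc.convexOn_toReal hP.φ_convex).1
  have hd : ∀ z ∈ S, ContDiffAt ℝ 2 P.f z := fun z hz => hP.contDiffAt_f hz.2
  have hxsS : xs ∈ S := ⟨Metric.mem_closedBall_self hε.le, hxs.1⟩
  have hlin : ∀ y z : E n, ‖P.linA y - P.linA z‖ ≤ ‖P.linA‖ * ‖y - z‖ := fun y z => by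
    rw [← map_sub]; exact P.linA.le_opNorm _
  have hlip' : ∀ y ∈ S, ∀ z ∈ S, ‖hess P.ψr (P.aff y) - hess P.ψr (P.aff z)‖
      ≤ L * ‖P.linA‖ * ‖y - z‖ := fun y hy z hz => by
    refine (hlip y hy z hz).trans ?_
    rw [mul_assoc]
    gcongr
    exact hlin y z
  set L' := L * ‖P.linA‖ ^ 3 with hL'
  have hL'0 : 0 ≤ L' := by positivity
  have hH : ∀ y ∈ S, ∀ z ∈ S, ‖hess P.f y - hess P.f z‖ ≤ L' * ‖y - z‖ := by
    intro y hy z hz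
    rw [hP.hess_f hy.2, hP.hess_f hz.2, ← ContinuousLinearMap.comp_sub,
      ← ContinuousLinearMap.sub_comp]
    refine (ContinuousLinearMap.opNorm_comp_le _ _).trans ?_
    rw [LinearIsometryEquiv.norm_map]
    calc _ ≤ ‖P.linA‖ * (‖hess P.ψr (P.aff y) - hess P.ψr (P.aff z)‖ * ‖P.linA‖) := by
          gcongr; exact ContinuousLinearMap.opNorm_comp_le _ _
      _ ≤ ‖P.linA‖ * (L * ‖P.linA‖ * ‖y - z‖ * ‖P.linA‖) := by
          gcongr; exact hlip' y hy z hz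
      _ = _ := by rw [hL']; ring
  have hHb : ∀ x ∈ S, ‖hess P.f x‖ ≤ ‖hess P.f xs‖ + L' := by
    intro x hx
    have h1 := hH x hx xs hxsS
    have h2 : ‖x - xs‖ ≤ 1 := by
      rw [← dist_eq_norm]; exact (Metric.mem_closedBall.mp hx.1).trans hε1
    have h3 : ‖hess P.f x‖ ≤ ‖hess P.f xs‖ + ‖hess P.f x - hess P.f xs‖ := by
      have := norm_add_le (hess P.f xs) (hess P.f x - hess P.f xs)
      simpa using this
    nlinarith
  have hK0 : 0 ≤ ‖hess P.f xs‖ := norm_nonneg _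
  refine ⟨‖hess P.f xs‖ + 3 * L' + a * L', by positivity, ?_, ?_, ?_, ?_, ?_⟩
  · intro x hx y hy
    refine (norm_gradient_sub_le hconv hd hL'0 hH hx hy).trans ?_
    exact mul_le_mul_of_nonneg_right (by nlinarith) (by positivity)
  · intro x hx y hy
    refine (abs_taylor_le hconv hd hL'0 hH hx hy).trans ?_
    exact mul_le_mul_of_nonneg_right (by nlinarith) (by positivity)
  · intro x hx y hy
    refine (hconv.norm_image_sub_le_of_norm_hasFDerivWithin_le
      (fun z hz => (hasFDerivAt_gradient (hd z hz)).hasFDerivWithinAt) hHb hx hy).trans ?_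
    exact mul_le_mul_of_nonneg_right (by nlinarith) (by positivity)
  · intro x hx
    refine (hHb x hx).trans ?_
    nlinarith
  · intro x hx z hz
    have h1 := neg_le_lambdaMin hz.2.2.2 (hlip' x hx z ⟨hz.1, hz.2.1⟩)
    have h2 : P.Lam a x ≤ a * (L * ‖P.linA‖ * ‖x - z‖) := by
      unfold Lam
      gcongr
      exact max_le (by positivity) (by linarith)
    calc P.Lam a x * ‖P.linA‖ ^ 2 ≤ a * (L * ‖P.linA‖ * ‖x - z‖) * ‖P.linA‖ ^ 2 := by gcongr
      _ = a * L' * ‖x - z‖ := by rw [hL']; ring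
      _ ≤ _ := by gcongr; nlinarith

/-- A subgradient of `φ`, which makes the proximity operator well defined. -/
lemma Standing.isSubgradient_strongStat {z : E n} (hz : z ∈ P.strongStat) :
    IsSubgradient P.φ z (-gradient P.f z) :=
  hP.isSubgradient_of_limiting hz.2.1

variable {xs : E n} (hxs : xs ∈ P.strongStat)
include hxs

lemma Standing.isSubgradient_prox (x : E n) : IsSubgradient P.φ (prox P.φ x) (x - prox P.φ x) :=
  ProxNewton.isSubgradient_prox hP.φ_lsc hP.φ_convex (hP.isSubgradient_strongStat hxs) x

lemma Standing.norm_prox_sub_prox_le (x y : E n) : ‖prox P.φ x - prox P.φ y‖ ≤ ‖x - y‖ :=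
  ProxNewton.norm_prox_sub_prox_le hP.φ_lsc hP.φ_convex (hP.isSubgradient_strongStat hxs) x y

lemma Standing.r_eq_zero : P.r xs = 0 := by
  have hsub := hP.isSubgradient_strongStat hxs
  rw [r, prox_eq hP.φ_lsc hP.φ_convex hsub (y := xs) (by simpa using hsub), sub_self]

lemma Standing.isSubgradient_of_r_eq_zero {x : E n} (hx : P.r x = 0) :
    IsSubgradient P.φ x (-gradient P.f x) := by
  have h1 : prox P.φ (x - gradient P.f x) = x := (sub_eq_zero.mp hx).symm
  have h2 := hP.isSubgradient_prox hxs (x - gradient P.f x)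
  rw [h1] at h2
  simpa using h2

variable {a ε M : ℝ} (ha : 1 ≤ a) (hε1 : ε ≤ 1) (hB : P.LocalBounds a xs ε M)
include hB

lemma Standing.norm_r_le {x z : E n} (hx : x ∈ Metric.closedBall xs ε ∩ dom P.φ)
    (hz : z ∈ Metric.closedBall xs ε ∩ P.strongStat) : ‖P.r x‖ ≤ (2 + M) * ‖x - z‖ := by
  have h1 : P.r x = (x - z) - (prox P.φ (x - gradient P.f x) - prox P.φ (z - gradient P.f z)) := by
    have := hP.r_eq_zero hz.2
    rw [r, sub_eq_zero] at this
    rw [r, ← this]; abel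
  have h2 := hP.norm_prox_sub_prox_le hxs (x - gradient P.f x) (z - gradient P.f z)
  have h3 : x - gradient P.f x - (z - gradient P.f z)
      = (x - z) - (gradient P.f x - gradient P.f z) := by abel
  rw [h3] at h2
  have h4 := norm_sub_le (x - z) (gradient P.f x - gradient P.f z)
  have h5 := hB.grad_lipschitz z ⟨hz.1, hz.2.1⟩ x hx
  rw [h1]
  have h6 := norm_sub_le (x - z)
    (prox P.φ (x - gradient P.f x) - prox P.φ (z - gradient P.f z))
  linarith

include ha hε1

omit hP in
lemma norm_G_le {μ : ℝ} (hμ : 0 ≤ μ) {x : E n}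
    (hx : x ∈ Metric.closedBall xs ε ∩ dom P.φ) (v : E n) :
    ‖P.G a μ x v‖ ≤ (2 * M + μ) * ‖v‖ := by
  have hε : 0 ≤ ε := dist_nonneg.trans (Metric.mem_closedBall.mp hx.1)
  have h1 := norm_G_sub_hess_le (P := P) ha hμ x v
  have h2 := (hess P.f x).le_of_opNorm_le (hB.hess_bound x hx) v
  have h3 := hB.lam_bound x hx xs ⟨Metric.mem_closedBall_self hε, hxs⟩
  have h4 : ‖x - xs‖ ≤ 1 := by
    rw [← dist_eq_norm]; exact (Metric.mem_closedBall.mp hx.1).trans hε1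
  have h5 : P.Lam a x * ‖P.linA‖ ^ 2 ≤ M := by nlinarith [hB.M_nonneg]
  have h6 : ‖P.G a μ x v‖ ≤ ‖P.G a μ x v - hess P.f x v‖ + ‖hess P.f x v‖ := by
    have := norm_add_le (P.G a μ x v - hess P.f x v) (hess P.f x v)
    simpa using this
  have h7 := mul_le_mul_of_nonneg_right h5 (norm_nonneg v)
  linarith

/-- The step length is controlled from below by the decrease of the residual of the subproblem. -/
lemma Standing.norm_r_sub_le {μ : ℝ} (hμ : 0 ≤ μ) {x : E n}
    (hx : x ∈ Metric.closedBall xs ε ∩ dom P.φ) (y : E n) :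
    ‖P.r x‖ - ‖P.R a μ x y‖ ≤ (2 + 2 * M + μ) * ‖y - x‖ := by
  have h1 : P.R a μ x y - P.r x = (y - x) - (prox P.φ (y - gradient P.f x - P.G a μ x (y - x))
      - prox P.φ (x - gradient P.f x)) := by
    rw [r, R]; abel
  have h2 := hP.norm_prox_sub_prox_le hxs (y - gradient P.f x - P.G a μ x (y - x))
    (x - gradient P.f x)
  have h3 : y - gradient P.f x - P.G a μ x (y - x) - (x - gradient P.f x)
      = (y - x) - P.G a μ x (y - x) := by abel
  rw [h3] at h2
  have h4 := norm_sub_le (y - x) (P.G a μ x (y - x))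
  have h5 := norm_G_le hxs ha hε1 hB hμ hx (y - x)
  have h6 := norm_sub_le (y - x) (prox P.φ (y - gradient P.f x - P.G a μ x (y - x))
      - prox P.φ (x - gradient P.f x))
  rw [← h1] at h6
  have h7 := norm_sub_norm_le (P.r x) (P.R a μ x y)
  rw [norm_sub_rev] at h7
  linarith

/-- The step length is controlled from above by the distance to a stationary point. -/
lemma Standing.mul_norm_step_le {μ : ℝ} (hμ : 0 ≤ μ) {x z : E n}
    (hx : x ∈ Metric.closedBall xs ε ∩ dom P.φ)
    (hz : z ∈ Metric.closedBall xs ε ∩ P.strongStat) (y : E n) :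
    μ * ‖y - x‖ ≤ (1 + 2 * M + 2 * μ) * ‖P.R a μ x y‖ + 2 * M * ‖x - z‖ ^ 2
      + 2 * μ * ‖x - z‖ := by
  set e := P.R a μ x y with he
  -- `u` is an exact prox value, so it carries an exact subgradient to compare with the one at `z`;
  -- the errors are collected in `w`.
  set u := y - e with hu
  set B := P.G a μ x with hBdef
  have hprox : prox P.φ (y - gradient P.f x - B (y - x)) = u := by
    rw [hu, he, R]; abel
  have hsub := hP.isSubgradient_prox hxs (y - gradient P.f x - B (y - x))
  rw [hprox] at hsub
  have hmono := hsub.monotone (hP.isSubgradient_strongStat hz.2)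
  set w := (e - B e) - (gradient P.f x - gradient P.f z - B (x - z)) with hw
  have h1 : y - gradient P.f x - B (y - x) - u - -gradient P.f z = w - B (u - z) := by
    have : y - x = (u - z) + e - (x - z) := by rw [hu]; abel
    rw [this, map_sub, map_add, hw, hu]
    abel
  rw [h1, inner_sub_left, real_inner_comm (u - z) (B (u - z)), inner_G_eq] at hmono
  have hpos := hP.inner_H_nonneg ha hx.2 (u - z)
  -- Monotonicity together with G ⪰ μI gives μ‖u - z‖² ≤ ⟪w, u - z⟫.
  have h2 : μ * ‖u - z‖ ≤ ‖w‖ := by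
    have h3 := real_inner_le_norm w (u - z)
    by_contra hlt
    push Not at hlt
    have h4 : 0 < ‖u - z‖ := by
      rcases (norm_nonneg (u - z)).eq_or_lt with h | h
      · rw [← h, mul_zero] at hlt
        exact absurd hlt (not_lt.mpr (norm_nonneg _))
      · exact h
    nlinarith
  have h3 : ‖w‖ ≤ ‖e‖ + (2 * M + μ) * ‖e‖ + (2 * M * ‖x - z‖ ^ 2 + μ * ‖x - z‖) := by
    have a1 := norm_sub_le (e - B e) (gradient P.f x - gradient P.f z - B (x - z))
    have a2 := norm_sub_le e (B e)
    have a3 := norm_G_le hxs ha hε1 hB hμ hx e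
    have a4 := hB.grad_taylor x hx z ⟨hz.1, hz.2.1⟩
    have a5 := norm_G_sub_hess_le (P := P) ha hμ x (x - z)
    have a6 : gradient P.f x - gradient P.f z - B (x - z)
        = -(gradient P.f z - gradient P.f x - hess P.f x (z - x))
          - (B (x - z) - hess P.f x (x - z)) := by
      rw [← neg_sub x z, map_neg]; abel
    have a7 := norm_sub_le (-(gradient P.f z - gradient P.f x - hess P.f x (z - x)))
      (B (x - z) - hess P.f x (x - z))
    rw [← a6, norm_neg] at a7
    rw [norm_sub_rev z x] at a4
    have a8 := hB.lam_bound x hx z hz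
    have a9 := mul_le_mul_of_nonneg_right a8 (norm_nonneg (x - z))
    nlinarith
  have h4 : ‖y - x‖ ≤ ‖u - z‖ + ‖e‖ + ‖x - z‖ := by
    have : y - x = (u - z) + e - (x - z) := by rw [hu]; abel
    rw [this]
    have b1 := norm_sub_le (u - z + e) (x - z)
    have b2 := norm_add_le (u - z) e
    linarith
  have h5 := mul_le_mul_of_nonneg_left h4 hμ
  nlinarith

omit hε1 in
/-- The residual at the new point. -/
lemma Standing.norm_r_step_le {μ : ℝ} (hμ : 0 ≤ μ) {x y z : E n}
    (hx : x ∈ Metric.closedBall xs ε ∩ dom P.φ) (hy : y ∈ Metric.closedBall xs ε ∩ dom P.φ)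
    (hz : z ∈ Metric.closedBall xs ε ∩ P.strongStat) :
    ‖P.r y‖ ≤ M * ‖y - x‖ ^ 2 + (M * ‖x - z‖ + μ) * ‖y - x‖ + ‖P.R a μ x y‖ := by
  have h1 : P.r y = P.R a μ x y - (prox P.φ (y - gradient P.f y)
      - prox P.φ (y - gradient P.f x - P.G a μ x (y - x))) := by
    rw [r, R]; abel
  have h2 := hP.norm_prox_sub_prox_le hxs (y - gradient P.f y)
    (y - gradient P.f x - P.G a μ x (y - x))
  have h3 : y - gradient P.f y - (y - gradient P.f x - P.G a μ x (y - x))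
      -- The two prox arguments differ by the perturbation G - ∇²f applied to the step, minus the
      -- Taylor remainder of ∇f.
      = (P.G a μ x (y - x) - hess P.f x (y - x))
        - (gradient P.f y - gradient P.f x - hess P.f x (y - x)) := by abel
  rw [h3] at h2
  have h4 := norm_sub_le (P.G a μ x (y - x) - hess P.f x (y - x))
    (gradient P.f y - gradient P.f x - hess P.f x (y - x))
  have h5 := hB.grad_taylor x hx y hy
  have h6 := norm_G_sub_hess_le (P := P) ha hμ x (y - x)
  have h7 := mul_le_mul_of_nonneg_right (hB.lam_bound x hx z hz) (norm_nonneg (y - x))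
  have h8 := norm_sub_le (P.R a μ x y) (prox P.φ (y - gradient P.f y)
      - prox P.φ (y - gradient P.f x - P.G a μ x (y - x)))
  rw [← h1] at h8
  linarith

omit hxs ha hε1 in
-- The φ-terms cancel, leaving the second-order Taylor remainder of f.
lemma Standing.abs_ared_sub_pred_le {x y : E n}
    (hx : x ∈ Metric.closedBall xs ε ∩ dom P.φ) (hy : y ∈ Metric.closedBall xs ε ∩ dom P.φ) :
    |P.ared x y - P.pred x y| ≤ M * ‖y - x‖ ^ 3 := by
  rw [hP.ared_eq hx.2 hy.2, hP.pred_eq hx.2 hy.2, abs_sub_comm]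
  convert hB.taylor x hx y hy using 2
  ring

end Standing

end Problem

/-! ### Scalar estimates -/

lemma exists_rpow_lt {s c : ℝ} (hs : 0 < s) (hc : 0 < c) :
    ∃ r₀ : ℝ, 0 < r₀ ∧ r₀ ≤ 1 ∧ ∀ r : ℝ, 0 < r → r < r₀ → r ^ s < c := by
  refine ⟨min 1 (c ^ (1 / s)), lt_min one_pos (Real.rpow_pos_of_pos hc _), min_le_left _ _,
    fun r hr h => ?_⟩
  have h1 := Real.rpow_lt_rpow hr.le (h.trans_le (min_le_right _ _)) hs
  rwa [← Real.rpow_mul hc.le, one_div_mul_cancel hs.ne', Real.rpow_one] at h1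

/-- Every term on the right of `h` is O(μD): r^δ ≤ μ/ν_min, then e ≤ r · r^δ = O(Dμ) because τ ≥ δ,
and D² ≤ D · B r^δ because q > δ. Division by μ gives the claim. -/
lemma step_le_of_scalar {M K B δ τ q νmin ν r D d e : ℝ} (hM : 0 ≤ M) (hν : 0 < νmin)
    (hνν : νmin ≤ ν) (hδτ : δ ≤ τ) (hδq : δ < q) (hr : 0 < r) (hr1 : r ≤ 1) (hδ : 0 < δ)
    (hD : 0 ≤ D) (hB : 0 ≤ B) (hrD : r ≤ K * D) (hDr : D ≤ B * r ^ q) (he : e ≤ r ^ (1 + τ))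
    (h : ν * r ^ δ * d ≤ (1 + 2 * M + 2 * (ν * r ^ δ)) * e + 2 * M * D ^ 2
      + 2 * (ν * r ^ δ) * D) :
    d ≤ ((1 + 2 * M) * K * νmin⁻¹ + 2 * K + 2 * M * B * νmin⁻¹ + 2) * D := by
  have hrδ : 0 < r ^ δ := Real.rpow_pos_of_pos hr _
  set μ := ν * r ^ δ with hμ
  have hμ0 : 0 < μ := mul_pos (hν.trans_le hνν) hrδ
  have hi : r ^ δ ≤ νmin⁻¹ * μ := by
    rw [hμ, ← mul_assoc]
    refine le_mul_of_one_le_left hrδ.le ?_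
    rw [inv_mul_eq_div, one_le_div hν]
    exact hνν
  have hKD : 0 ≤ K * D := hr.le.trans hrD
  have e1 : e ≤ K * D * (νmin⁻¹ * μ) := by
    calc e ≤ r ^ (1 + τ) := he
      _ ≤ r ^ (1 + δ) := Real.rpow_le_rpow_of_exponent_ge hr hr1 (by linarith)
      _ = r * r ^ δ := by rw [Real.rpow_add hr, Real.rpow_one]
      _ ≤ K * D * (νmin⁻¹ * μ) := by gcongr
  have e2 : e ≤ K * D := by
    calc e ≤ r ^ (1 + τ) := he
      _ ≤ r ^ (1 : ℝ) := Real.rpow_le_rpow_of_exponent_ge hr hr1 (by linarith)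
      _ ≤ K * D := by rwa [Real.rpow_one]
  have e3 : D ≤ B * (νmin⁻¹ * μ) := by
    calc D ≤ B * r ^ q := hDr
      _ ≤ B * r ^ δ := by
        gcongr ?_ * ?_
        exact Real.rpow_le_rpow_of_exponent_ge hr hr1 hδq.le
      _ ≤ _ := by gcongr
  have e4 := mul_le_mul_of_nonneg_left e1 (by linarith : 0 ≤ 1 + 2 * M)
  have e5 := mul_le_mul_of_nonneg_left e2 (by linarith : 0 ≤ 2 * μ)
  have e6 := mul_le_mul_of_nonneg_left e3 (by positivity : 0 ≤ 2 * M * D)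
  refine le_of_mul_le_mul_left ?_ hμ0
  nlinarith

/-- As d = O(D) and D² ≤ B r^δ D, the quadratic terms join μd in O(r^δ D). Keeping this mixed
product lets `residual_le_rpow` eliminate D and `residual_le_dist_rpow` eliminate r. -/
lemma residual_le_of_scalar {M C₁ B δ τ q νbar ν r r' D d e : ℝ} (hM : 0 ≤ M) (hC₁ : 0 ≤ C₁)
    (hνν : ν ≤ νbar) (hν : 0 ≤ ν) (hδq : δ < q) (hr : 0 < r) (hr1 : r ≤ 1)
    (hD : 0 ≤ D) (hB : 0 ≤ B) (hd : 0 ≤ d) (hDr : D ≤ B * r ^ q) (he : e ≤ r ^ (1 + τ))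
    (hdD : d ≤ C₁ * D) (h : r' ≤ M * d ^ 2 + (M * D + ν * r ^ δ) * d + e) :
    r' ≤ (B * (M * C₁ ^ 2 + M * C₁) + νbar * C₁) * (r ^ δ * D) + r ^ (1 + τ) := by
  have hrδ : 0 < r ^ δ := Real.rpow_pos_of_pos hr _
  have e1 : D * D ≤ B * r ^ δ * D := by
    gcongr
    refine hDr.trans ?_
    gcongr ?_ * ?_
    exact Real.rpow_le_rpow_of_exponent_ge hr hr1 hδq.le
  have e2 : M * d ^ 2 ≤ M * (C₁ * D) ^ 2 := by gcongr
  have e3 : (M * D + ν * r ^ δ) * d ≤ (M * D + νbar * r ^ δ) * (C₁ * D) := by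
    have : 0 ≤ νbar := hν.trans hνν
    gcongr
  have e4 := mul_le_mul_of_nonneg_left e1 (by positivity : 0 ≤ M * C₁ ^ 2 + M * C₁)
  nlinarith

lemma residual_le_rpow {C₂ B δ τ q r r' D : ℝ} (hC₂ : 0 ≤ C₂) (hr : 0 < r) (hr1 : r ≤ 1)
    (hB : 0 ≤ B) (hDr : D ≤ B * r ^ q) (h : r' ≤ C₂ * (r ^ δ * D) + r ^ (1 + τ)) :
    r' ≤ (C₂ * B + 1) * r ^ min (1 + τ) (δ + q) := by
  have h1 : r ^ (1 + τ) ≤ r ^ min (1 + τ) (δ + q) :=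
    Real.rpow_le_rpow_of_exponent_ge hr hr1 (min_le_left _ _)
  have h2 : r ^ (δ + q) ≤ r ^ min (1 + τ) (δ + q) :=
    Real.rpow_le_rpow_of_exponent_ge hr hr1 (min_le_right _ _)
  have h3 : r ^ δ * D ≤ B * r ^ (δ + q) := by
    rw [Real.rpow_add hr]
    have := mul_le_mul_of_nonneg_left hDr (Real.rpow_pos_of_pos hr δ).le
    linarith
  have h4 : C₂ * (r ^ δ * D) ≤ C₂ * (B * r ^ min (1 + τ) (δ + q)) :=
    mul_le_mul_of_nonneg_left (h3.trans (mul_le_mul_of_nonneg_left h2 hB)) hC₂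
  linarith

lemma residual_le_dist_rpow {C₂ K δ τ r r' D : ℝ} (hC₂ : 0 ≤ C₂) (hr : 0 < r) (hr1 : r ≤ 1)
    (hK : 0 ≤ K) (hD : 0 < D) (hδ : 0 < δ) (hδτ : δ ≤ τ) (hrD : r ≤ K * D)
    (h : r' ≤ C₂ * (r ^ δ * D) + r ^ (1 + τ)) :
    r' ≤ (C₂ * K ^ δ + K ^ (1 + δ)) * D ^ (1 + δ) := by
  have h1 : r ^ δ * D ≤ K ^ δ * D ^ (1 + δ) := by
    have := Real.rpow_le_rpow hr.le hrD hδ.le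
    rw [Real.mul_rpow hK hD.le] at this
    rw [Real.rpow_add hD, Real.rpow_one]
    nlinarith
  have h2 : r ^ (1 + τ) ≤ K ^ (1 + δ) * D ^ (1 + δ) := by
    refine (Real.rpow_le_rpow_of_exponent_ge hr hr1 (by linarith : 1 + δ ≤ 1 + τ)).trans ?_
    rw [← Real.mul_rpow hK hD.le]
    exact Real.rpow_le_rpow hr.le hrD (by linarith)
  have h3 := mul_le_mul_of_nonneg_left h1 hC₂
  linarith

namespace Problem

variable {P : Problem m n} {p : Params}

/-! ### Successful steps near a strongly stationary point -/

/-- Since pred ≥ ν_min r^δ d²/2 and d is at least a multiple of r, pred is at least a multiple of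
r^(1+δ) d, which beats r^κ d as κ > 1 + δ. Moreover |1 - ared/pred| = O(d/r^δ) = O(r^(q-δ)). `hs1`
and `hs2` say that r is small enough for both. -/
lemma successful_of_scalar {ν r d D C₁ B M q : ℝ} {x y : E n} (hM : 0 ≤ M)
    (hν : p.νmin ≤ ν) (hν' : ν ≤ p.νbar) (hr : 0 < r) (hr1 : r ≤ 1) (hrx : ‖P.r x‖ = r)
    (hd : ‖y - x‖ = d) (hdD : d ≤ C₁ * D) (hDr : D ≤ B * r ^ q)
    (hC₁ : 0 ≤ C₁)
    (hlow : (1 - p.θ) * r ≤ (2 + 2 * M + ν * r ^ p.δ) * d)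
    (hpred : (1 + p.α) * (ν * r ^ p.δ) / 2 * d ^ 2 ≤ P.pred x y)
    (hared : |P.ared x y - P.pred x y| ≤ M * d ^ 3)
    (hs1 : r ^ (p.κ - 1 - p.δ) < p.νmin / (2 * p.pmin * (2 + 2 * M + p.νbar)))
    (hs2 : r ^ (q - p.δ) < (1 - p.c₁) * p.νmin / (2 * (M * C₁ * B + 1)))
    (hB : 0 ≤ B) :
    ¬ P.Unsuccessful p x y := by
  have hνm := p.νmin_pos
  have hν0 : 0 < ν := hνm.trans_le hν
  have hνb : 0 < p.νbar := hν0.trans_le hν'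
  have hrδ : 0 < r ^ p.δ := Real.rpow_pos_of_pos hr _
  have hrδ1 : r ^ p.δ ≤ 1 := Real.rpow_le_one hr.le hr1 p.δ_mem.1.le
  have hθ := p.θ_mem.2
  have hpm := p.pmin_mem.1
  have hα := p.α_mem.1
  have hc₁ := p.c₁_mem.2
  have hc₀ := p.c₁_mem.1
  set N := 2 + 2 * M + p.νbar with hN
  have hN0 : 0 < N := by linarith
  have hlow' : (1 - p.θ) * r ≤ N * d := by
    have hd0 : 0 ≤ d := hd ▸ norm_nonneg _
    have : ν * r ^ p.δ ≤ p.νbar := by nlinarith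
    refine hlow.trans ?_
    gcongr
    rw [hN]; linarith
  have hd0 : 0 < d := by
    have : 0 < N * d := lt_of_lt_of_le (mul_pos (by linarith) hr) hlow'
    exact pos_of_mul_pos_right this hN0.le
  have hμd : p.νmin * r ^ p.δ ≤ ν * r ^ p.δ := by gcongr
  have hpred' : p.νmin * r ^ p.δ / 2 * d ^ 2 ≤ P.pred x y := by
    refine le_trans ?_ hpred
    have : p.νmin * r ^ p.δ ≤ (1 + p.α) * (ν * r ^ p.δ) := by
      have h0 : 0 < ν * r ^ p.δ := by positivity
      nlinarith
    gcongr
  have hpred0 : 0 < P.pred x y := lt_of_lt_of_le (by positivity) hpred'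
  rw [Unsuccessful, not_or, not_le, not_le, hrx, hd]
  constructor
  · refine lt_of_lt_of_le ?_ hpred'
    have hsplit : r ^ p.κ = r ^ (p.κ - 1 - p.δ) * (r ^ p.δ * r) := by
      rw [← Real.rpow_add_one hr.ne', ← Real.rpow_add hr]
      congr 1; ring
    rw [lt_div_iff₀ (by positivity)] at hs1
    have h1 : p.pmin * r ^ p.κ * N < p.νmin * r ^ p.δ / 2 * r := by
      rw [hsplit]
      have := mul_lt_mul_of_pos_right hs1 (by positivity : 0 < r ^ p.δ * r)
      nlinarith
    have h2 : (1 - p.θ) * (p.pmin * r ^ p.κ) * N < p.νmin * r ^ p.δ / 2 * (N * d) := by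
      calc (1 - p.θ) * (p.pmin * r ^ p.κ) * N = (1 - p.θ) * (p.pmin * r ^ p.κ * N) := by ring
        _ < (1 - p.θ) * (p.νmin * r ^ p.δ / 2 * r) := by
          apply mul_lt_mul_of_pos_left h1; linarith
        _ = p.νmin * r ^ p.δ / 2 * ((1 - p.θ) * r) := by ring
        _ ≤ _ := by gcongr
    have h3 : (1 - p.θ) * (p.pmin * r ^ p.κ) < p.νmin * r ^ p.δ / 2 * d := by
      refine lt_of_mul_lt_mul_right (a := N) ?_ hN0.le
      linarith
    calc p.pmin * (1 - p.θ) * d * min r (r ^ p.κ) ≤ p.pmin * (1 - p.θ) * d * r ^ p.κ := by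
          have : 0 ≤ p.pmin * (1 - p.θ) * d := by
            have : 0 < 1 - p.θ := by linarith
            positivity
          gcongr
          exact min_le_right _ _
      _ = (1 - p.θ) * (p.pmin * r ^ p.κ) * d := by ring
      _ < p.νmin * r ^ p.δ / 2 * d * d := by gcongr
      _ = _ := by ring
  · rw [ratio, lt_div_iff₀ hpred0]
    rw [lt_div_iff₀ (by positivity)] at hs2
    have hrq : r ^ q = r ^ (q - p.δ) * r ^ p.δ := by
      rw [← Real.rpow_add hr]; congr 1; ring
    have h1 : M * d ≤ M * C₁ * B * (r ^ (q - p.δ) * r ^ p.δ) := by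
      rw [← hrq]
      calc M * d ≤ M * (C₁ * (B * r ^ q)) := by
            gcongr
            exact hdD.trans (by gcongr)
        _ = _ := by ring
    have h2 : M * d < (1 - p.c₁) * p.νmin / 2 * r ^ p.δ := by
      have h3 : 0 < r ^ (q - p.δ) := Real.rpow_pos_of_pos hr _
      have h4 : M * C₁ * B * r ^ (q - p.δ) < (1 - p.c₁) * p.νmin / 2 := by nlinarith
      calc M * d ≤ M * C₁ * B * (r ^ (q - p.δ) * r ^ p.δ) := h1
        _ = M * C₁ * B * r ^ (q - p.δ) * r ^ p.δ := by ring
        _ < _ := mul_lt_mul_of_pos_right h4 hrδ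
    have h5 := (abs_le.mp hared).1
    have h6 : M * d ^ 3 < (1 - p.c₁) * (p.νmin * r ^ p.δ / 2 * d ^ 2) := by
      calc M * d ^ 3 = M * d * d ^ 2 := by ring
        _ < (1 - p.c₁) * p.νmin / 2 * r ^ p.δ * d ^ 2 :=
          mul_lt_mul_of_pos_right h2 (by positivity)
        _ = _ := by ring
    have h7 := mul_le_mul_of_nonneg_left hpred' (by linarith : 0 ≤ 1 - p.c₁)
    linarith

/-- The residual is controlled by the distance to the set of strongly stationary points. -/
lemma Standing.norm_r_le_infDist (hP : P.Standing) {a ε M : ℝ} {xs : E n}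
    (hxs : xs ∈ P.strongStat) (hB : P.LocalBounds a xs ε M) {x : E n} (hx : x ∈ dom P.φ)
    (hxε : ‖x - xs‖ ≤ ε / 4) : ‖P.r x‖ ≤ (2 + M) * Metric.infDist x P.strongStat := by
  have hM := hB.M_nonneg
  have hε : 0 ≤ ε := by linarith [norm_nonneg (x - xs)]
  have hxS : x ∈ Metric.closedBall xs ε ∩ dom P.φ :=
    ⟨by rw [Metric.mem_closedBall, dist_eq_norm]; linarith, hx⟩
  rw [← div_le_iff₀' (by linarith), Metric.le_infDist ⟨xs, hxs⟩]
  intro z hz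
  rw [div_le_iff₀' (by linarith), dist_eq_norm]
  by_cases hzb : z ∈ Metric.closedBall xs ε
  · exact hP.norm_r_le hxs hB hxS ⟨hzb, hz⟩
  -- A point `z` outside the ball is farther from `x` than `xs` is, so the bound for `xs` suffices.
  · refine (hP.norm_r_le hxs hB hxS ⟨Metric.mem_closedBall_self hε, hxs⟩).trans ?_
    have h1 : ε < ‖z - xs‖ := by
      rw [Metric.mem_closedBall, dist_eq_norm, not_le] at hzb
      exact hzb
    have h2 : ‖z - xs‖ ≤ ‖x - z‖ + ‖x - xs‖ := by
      rw [norm_sub_rev x z]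
      exact norm_sub_le_norm_sub_add_norm_sub z x xs
    gcongr
    linarith

set_option maxHeartbeats 1000000 in
/-- From a nonstationary point near `xs`, with the current regularization parameter, every inexact
subproblem solution is accepted, is close, and reduces the residual and the distance to the set of
strongly stationary points superlinearly. -/
lemma Standing.exists_local_step (hP : P.Standing) {xs : E n} {q ε L β : ℝ}
    (hxs : xs ∈ P.strongStat) (hq : max p.δ (1 - p.δ) < q) (hε : 0 < ε) (hL : 0 < L)
    (hlip : ∀ y ∈ Metric.closedBall xs ε ∩ dom P.φ, ∀ z ∈ Metric.closedBall xs ε ∩ dom P.φ,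
      ‖hess P.ψr (P.aff y) - hess P.ψr (P.aff z)‖ ≤ L * ‖P.linA y - P.linA z‖)
    (hβ : 0 < β) (heb : ∀ y ∈ Metric.closedBall xs ε ∩ dom P.φ,
      β * Metric.infDist y P.strongStat ≤ ‖P.r y‖ ^ q) :
    ∃ ε₁ C K : ℝ, 0 < ε₁ ∧ 0 < C ∧ 0 ≤ K ∧ ∀ x ∈ dom P.φ, ‖x - xs‖ ≤ ε₁ →
      ‖P.r x‖ ≤ K * ‖x - xs‖ ∧ ∀ (y : E n) (ν : ℝ), p.νmin ≤ ν → ν ≤ p.νbar → 0 < ‖P.r x‖ →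
      P.Inexact p (ν * ‖P.r x‖ ^ p.δ) x y →
      ¬ P.Unsuccessful p x y ∧ ‖y - x‖ ≤ C * ‖P.r x‖ ^ q ∧
      ‖P.r y‖ ≤ C * ‖P.r x‖ ^ min (1 + p.τ) (p.δ + q) ∧ ‖P.r y‖ ≤ p.η * ‖P.r x‖ ∧
      Metric.infDist y P.strongStat
        ≤ C * Metric.infDist x P.strongStat ^ ((1 + p.δ) * q) := by
  wlog hε1 : ε ≤ 1 generalizing ε
  · have hsub : Metric.closedBall xs 1 ∩ dom P.φ ⊆ Metric.closedBall xs ε ∩ dom P.φ :=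
      Set.inter_subset_inter_left _ (Metric.closedBall_subset_closedBall (not_le.mp hε1).le)
    exact this one_pos (fun y hy z hz => hlip y (hsub hy) z (hsub hz))
      (fun y hy => heb y (hsub hy)) le_rfl
  have ha := p.one_le_a
  obtain ⟨M, hB⟩ := hP.exists_localBounds ha hxs hε hε1 hL hlip
  have hM := hB.M_nonneg
  have hδ := p.δ_mem.1
  have hδ1 := p.δ_mem.2
  have hδτ := p.δ_le_τ
  have hδq : p.δ < q := (le_max_left _ _).trans_lt hq
  have hδq' : 1 < p.δ + q := by linarith [(le_max_right p.δ (1 - p.δ)).trans_lt hq]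
  have hνm := p.νmin_pos
  have hνb : 0 < p.νbar := hνm.trans_le (p.νmin_le.trans p.ν₀_le)
  have hη := p.η_mem.1
  have hc₁ := p.c₁_mem.2
  have hpm := p.pmin_mem.1
  have hθ0 := p.θ_mem.1
  have hθ1 := p.θ_mem.2
  have hq0 : 0 < q := hδ.trans hδq
  set K := 2 + M with hK
  have hK0 : 0 < K := by linarith
  set B := 2 / β with hBd
  have hB0 : 0 < B := by positivity
  set C₁ := (1 + 2 * M) * K * p.νmin⁻¹ + 2 * K + 2 * M * B * p.νmin⁻¹ + 2 with hC₁
  have hC₁0 : 0 < C₁ := by positivity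
  set C₂ := B * (M * C₁ ^ 2 + M * C₁) + p.νbar * C₁ with hC₂
  have hC₂0 : 0 < C₂ := by positivity
  set C₃ := C₂ * K ^ p.δ + K ^ (1 + p.δ) with hC₃
  have hC₃0 : 0 < C₃ := by
    have := Real.rpow_pos_of_pos hK0 p.δ
    have := Real.rpow_pos_of_pos hK0 (1 + p.δ)
    positivity
  set ρ := min (1 + p.τ) (p.δ + q) with hρ
  have hρ1 : 1 < ρ := lt_min (by linarith) hδq'
  obtain ⟨r₁, hr₁, hr₁1, h₁⟩ := exists_rpow_lt (s := p.κ - 1 - p.δ)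
    (c := p.νmin / (2 * p.pmin * (2 + 2 * M + p.νbar))) (by linarith [p.κ_gt]) (by positivity)
  obtain ⟨r₂, hr₂, hr₂1, h₂⟩ := exists_rpow_lt (s := q - p.δ)
    (c := (1 - p.c₁) * p.νmin / (2 * (M * C₁ * B + 1))) (by linarith)
    (div_pos (mul_pos (by linarith) hνm) (by positivity))
  -- `r₁` and `r₂` secure acceptance; `r₃` turns the order ρ > 1 into a reduction of the residual by
  -- η.
  obtain ⟨r₃, hr₃, hr₃1, h₃⟩ := exists_rpow_lt (s := ρ - 1) (c := p.η / (C₂ * B + 1))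
    (by linarith) (by positivity)
  set r₀ := min r₁ (min r₂ r₃) with hr₀
  have hr₀0 : 0 < r₀ := lt_min hr₁ (lt_min hr₂ hr₃)
  set C₄ := β⁻¹ * (C₃ ^ q * 2 ^ ((1 + p.δ) * q)) with hC₄
  have hC₄0 : 0 < C₄ := by
    have := Real.rpow_pos_of_pos hC₃0 q
    positivity
  -- The first radius keeps `y`, at distance at most (1 + 2C₁)‖x - xs‖ from `xs`, and `z`, at
  -- distance at most 3‖x - xs‖, in the ball; the second gives r < r₀.
  refine ⟨min (ε / (2 * C₁ + 4)) (r₀ / (2 * K)), C₁ * B + (C₂ * B + 1) + C₄, K,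
    lt_min (by positivity) (by positivity), by positivity, hK0.le, ?_⟩
  intro x hx hxε
  have hxε1 : ‖x - xs‖ * (2 * C₁ + 4) ≤ ε :=
    (le_div_iff₀ (by positivity)).mp (hxε.trans (min_le_left _ _))
  have hxε2 : ‖x - xs‖ * (2 * K) ≤ r₀ :=
    (le_div_iff₀ (by positivity)).mp (hxε.trans (min_le_right _ _))
  have hn0 := norm_nonneg (x - xs)
  have hx4 : ‖x - xs‖ ≤ ε / 4 := by
    have := mul_nonneg hn0 hC₁0.le
    linarith
  have hxS : x ∈ Metric.closedBall xs ε ∩ dom P.φ :=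
    ⟨by rw [Metric.mem_closedBall, dist_eq_norm]; linarith, hx⟩
  have hrK : ‖P.r x‖ ≤ K * ‖x - xs‖ :=
    hP.norm_r_le hxs hB hxS ⟨Metric.mem_closedBall_self hε.le, hxs⟩
  refine ⟨hrK, fun y ν hν hν' hr hinex => ?_⟩
  set r := ‖P.r x‖ with hrdef
  have hrr₀ : r < r₀ := by
    have : r ≤ r₀ / 2 := by linarith
    linarith
  have hr1 : r ≤ 1 := hrr₀.le.trans ((min_le_left _ _).trans hr₁1)
  have hs1 := h₁ r hr (hrr₀.trans_le (min_le_left _ _))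
  have hs2 := h₂ r hr (hrr₀.trans_le ((min_le_right _ _).trans (min_le_left _ _)))
  have hs3 := h₃ r hr (hrr₀.trans_le ((min_le_right _ _).trans (min_le_right _ _)))
  have hν0 : 0 < ν := hνm.trans_le hν
  have hrδ : 0 < r ^ p.δ := Real.rpow_pos_of_pos hr _
  have hμ0 : 0 ≤ ν * r ^ p.δ := by positivity
  have hrD' := hP.norm_r_le_infDist hxs hB hx hx4
  have hdist0 : 0 < Metric.infDist x P.strongStat := by
    by_contra hcon
    push Not at hcon
    exact absurd (hrD'.trans (mul_nonpos_of_nonneg_of_nonpos hK0.le hcon)) (not_le.mpr hr)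
  -- Doubling the positive distance leaves room for some `z` in X* with ‖x - z‖ < D, so no nearest
  -- point is needed.
  set D := 2 * Metric.infDist x P.strongStat with hD
  have hD0 : 0 < D := by positivity
  have hrD : r ≤ K * D := hrD'.trans (by gcongr; linarith)
  have hDr : D ≤ B * r ^ q := by
    have := heb x hxS
    rw [hBd, div_mul_eq_mul_div, le_div_iff₀ hβ]
    linarith
  have hDx : D ≤ 2 * ‖x - xs‖ := by
    have := Metric.infDist_le_dist_of_mem (x := x) hxs
    rw [dist_eq_norm] at this
    linarith
  obtain ⟨z, hz, hxz⟩ := (Metric.infDist_lt_iff ⟨xs, hxs⟩).mp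
    (by linarith : Metric.infDist x P.strongStat < D)
  rw [dist_eq_norm] at hxz
  have hzS : z ∈ Metric.closedBall xs ε ∩ P.strongStat := by
    refine ⟨?_, hz⟩
    rw [Metric.mem_closedBall, dist_eq_norm]
    have := norm_sub_le_norm_sub_add_norm_sub z x xs
    rw [norm_sub_rev z x] at this
    linarith
  have he := hinex.1
  have hrτ : 0 < r ^ (1 + p.τ) := Real.rpow_pos_of_pos hr _
  have he1 : ‖P.R p.a (ν * r ^ p.δ) x y‖ ≤ r ^ (1 + p.τ) := by
    refine he.trans ((mul_le_of_le_one_left (le_min hr.le hrτ.le) hθ1.le).trans ?_)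
    exact min_le_right _ _
  have he2 : ‖P.R p.a (ν * r ^ p.δ) x y‖ ≤ p.θ * r :=
    he.trans (mul_le_mul_of_nonneg_left (min_le_left _ _) hθ0.le)
  have hd0 := norm_nonneg (y - x)
  have hdD : ‖y - x‖ ≤ C₁ * D := by
    refine step_le_of_scalar hM hνm hν hδτ hδq hr hr1 hδ hD0.le hB0.le hrD hDr he1 ?_
    refine (hP.mul_norm_step_le hxs ha hε1 hB hμ0 hxS hzS y).trans ?_
    gcongr
  have hyD := hP.mem_dom_of_inexact hx hinex
  have hyS : y ∈ Metric.closedBall xs ε ∩ dom P.φ := by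
    refine ⟨?_, hyD⟩
    rw [Metric.mem_closedBall, dist_eq_norm]
    have h1 := norm_sub_le_norm_sub_add_norm_sub y x xs
    have h2 := mul_le_mul_of_nonneg_left hDx hC₁0.le
    linarith
  have hr' := residual_le_of_scalar (B := B) (τ := p.τ) hM hC₁0.le hν' hν0.le hδq hr hr1 hD0.le
    hB0.le hd0 hDr he1 hdD (r' := ‖P.r y‖) (by
      refine (hP.norm_r_step_le hxs ha hB hμ0 hxS hyS hzS).trans ?_
      gcongr)
  have hra := residual_le_rpow hC₂0.le hr hr1 hB0.le hDr hr'
  have hrb := residual_le_dist_rpow hC₂0.le hr hr1 hK0.le hD0 hδ hδτ hrD hr'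
  have hρpos : 0 < r ^ ρ := Real.rpow_pos_of_pos hr _
  refine ⟨?_, ?_, ?_, ?_, ?_⟩
  · refine successful_of_scalar hM hν hν' hr hr1 hrdef.symm rfl hdD hDr hC₁0.le ?_
      (hP.le_pred hx hinex) (hP.abs_ared_sub_pred_le hB hxS hyS) hs1 hs2 hB0.le
    have := hP.norm_r_sub_le hxs ha hε1 hB hμ0 hxS y
    linarith
  · calc ‖y - x‖ ≤ C₁ * D := hdD
      _ ≤ C₁ * (B * r ^ q) := by gcongr
      _ = C₁ * B * r ^ q := by ring
      _ ≤ _ := mul_le_mul_of_nonneg_right (by linarith [mul_pos hC₂0 hB0])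
          (Real.rpow_pos_of_pos hr q).le
  · exact hra.trans (mul_le_mul_of_nonneg_right (by linarith [mul_pos hC₁0 hB0]) hρpos.le)
  · refine hra.trans ?_
    rw [lt_div_iff₀ (by positivity)] at hs3
    have : r ^ ρ = r ^ (ρ - 1) * r := by
      rw [← Real.rpow_add_one hr.ne']; congr 1; ring
    rw [← hρ, this, ← mul_assoc]
    gcongr
    linarith
  · have h1 := heb y hyS
    have h2 : ‖P.r y‖ ^ q ≤ C₃ ^ q * 2 ^ ((1 + p.δ) * q)
        * Metric.infDist x P.strongStat ^ ((1 + p.δ) * q) := by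
      refine (Real.rpow_le_rpow (norm_nonneg _) hrb hq0.le).trans_eq ?_
      rw [Real.mul_rpow hC₃0.le (Real.rpow_nonneg hD0.le _), ← Real.rpow_mul hD0.le, hD,
        Real.mul_rpow two_pos.le hdist0.le, mul_assoc]
    have hpos := Real.rpow_pos_of_pos hdist0 ((1 + p.δ) * q)
    calc Metric.infDist y P.strongStat = β⁻¹ * (β * Metric.infDist y P.strongStat) := by
          field_simp
      _ ≤ β⁻¹ * (C₃ ^ q * 2 ^ ((1 + p.δ) * q)
        * Metric.infDist x P.strongStat ^ ((1 + p.δ) * q)) := by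
          exact mul_le_mul_of_nonneg_left (h1.trans h2) (inv_nonneg.mpr hβ.le)
      _ = C₄ * Metric.infDist x P.strongStat ^ ((1 + p.δ) * q) := by rw [hC₄]; ring
      _ ≤ _ := mul_le_mul_of_nonneg_right
          (by linarith [mul_pos hC₁0 hB0, mul_pos hC₂0 hB0]) hpos.le

/-- Steps from a stationary point close to `xs` are never accepted. -/
lemma Standing.exists_unsuccessful_of_r_eq_zero (hP : P.Standing) {xs : E n} {q ε L β : ℝ}
    (hxs : xs ∈ P.strongStat) (hq : 0 < q) (hε : 0 < ε) (hL : 0 < L)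
    (hlip : ∀ y ∈ Metric.closedBall xs ε ∩ dom P.φ, ∀ z ∈ Metric.closedBall xs ε ∩ dom P.φ,
      ‖hess P.ψr (P.aff y) - hess P.ψr (P.aff z)‖ ≤ L * ‖P.linA y - P.linA z‖)
    (hβ : 0 < β) (heb : ∀ y ∈ Metric.closedBall xs ε ∩ dom P.φ,
      β * Metric.infDist y P.strongStat ≤ ‖P.r y‖ ^ q) {x y : E n} (hx : x ∈ dom P.φ)
    (hxε : ‖x - xs‖ ≤ ε / 2) (hr : P.r x = 0) (hy : y ∈ dom P.φ) : P.Unsuccessful p x y := by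
  have hxS : x ∈ Metric.closedBall xs ε ∩ dom P.φ :=
    ⟨by rw [Metric.mem_closedBall, dist_eq_norm]; linarith, hx⟩
  have hdist : Metric.infDist x P.strongStat = 0 := by
    have h1 := heb x hxS
    rw [hr, norm_zero, Real.zero_rpow hq.ne'] at h1
    have := Metric.infDist_nonneg (x := x) (s := P.strongStat)
    nlinarith
  -- `x` is a limit of strongly stationary points, so λ_min ≥ 0 at `x` by the Lipschitz bound. With
  -- Λ = 0, `H` is ∇²f(x) itself, hence positive semidefinite.
  have hlam : P.Lam 1 x = 0 := by
    rw [Lam, one_mul, max_eq_left]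
    rw [neg_nonpos]
    refine le_of_forall_pos_lt_add fun c hc => ?_
    obtain ⟨z, hz, hxz⟩ := (Metric.infDist_lt_iff ⟨xs, hxs⟩).mp
      (by rw [hdist]; positivity :
        Metric.infDist x P.strongStat < min (ε / 2) (c / (2 * (L * ‖P.linA‖ + 1))))
    rw [dist_eq_norm] at hxz
    have hzS : z ∈ Metric.closedBall xs ε ∩ dom P.φ := by
      refine ⟨?_, hz.1⟩
      rw [Metric.mem_closedBall, dist_eq_norm]
      have := norm_sub_le_norm_sub_add_norm_sub z x xs
      rw [norm_sub_rev z x] at this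
      linarith [hxz.trans_le (min_le_left _ _)]
    have h1 := hlip x hxS z hzS
    rw [← map_sub] at h1
    have h2 := P.linA.le_opNorm (x - z)
    have h3 := neg_le_lambdaMin hz.2.2
      (h1.trans (mul_le_mul_of_nonneg_left h2 hL.le))
    have h4 := hxz.trans_le (min_le_right _ _)
    rw [lt_div_iff₀ (by positivity)] at h4
    have h5 : 0 ≤ L * ‖P.linA‖ := by positivity
    nlinarith [norm_nonneg (x - z)]
  have hpred : P.pred x y ≤ 0 := by
    rw [hP.pred_eq hx hy]
    have h1 := (hP.isSubgradient_of_r_eq_zero hxs hr).2 y hy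
    have h2 := hP.inner_H_nonneg le_rfl hx (y - x)
    rw [inner_H_eq, hlam] at h2
    rw [inner_neg_left] at h1
    linarith
  refine Or.inl (hpred.trans ?_)
  have h1 := p.pmin_mem.1
  have h2 : 0 < 1 - p.θ := by linarith [p.θ_mem.2]
  have h3 : 0 ≤ min ‖P.r x‖ (‖P.r x‖ ^ p.κ) :=
    le_min (norm_nonneg _) (Real.rpow_nonneg (norm_nonneg _) _)
  positivity

/-! ### Runs of the algorithm -/

section Run

variable {x xhat : ℕ → E n} {ν rbar μ : ℕ → ℝ} (hrun : P.IsRun p x xhat ν rbar μ)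
include hrun

lemma IsRun.mem_dom (hP : P.Standing) (k : ℕ) : x k ∈ dom P.φ := by
  induction k with
  | zero => exact hrun.x_zero
  | succ k ih =>
    rw [hrun.x_succ]
    split_ifs
    · exact ih
    · exact hP.mem_dom_of_inexact ih (hrun.inexact k)

lemma IsRun.νmin_le (k : ℕ) : p.νmin ≤ ν k := by
  have h1 := p.νmin_le.trans p.ν₀_le
  induction k with
  | zero => rw [hrun.ν_zero]; exact p.νmin_le
  | succ k ih =>
    rw [hrun.ν_succ]
    split_ifs
    · exact ih.trans (le_mul_of_one_le_left (p.νmin_pos.le.trans ih) p.one_lt_σ₂.le)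
    · exact le_min ih h1
    · exact le_min (le_max_right _ _) h1

lemma IsRun.ν_succ_le {k : ℕ} (h : ¬ P.Unsuccessful p (x k) (xhat k)) : ν (k + 1) ≤ p.νbar := by
  rw [hrun.ν_succ, if_neg h]
  split_ifs <;> exact min_le_right _ _

lemma IsRun.rbar_nonneg (k : ℕ) : 0 ≤ rbar k := by
  induction k with
  | zero => rw [hrun.rbar_zero]; exact norm_nonneg _
  | succ k ih =>
    rw [hrun.rbar_succ]
    split_ifs
    · exact norm_nonneg _
    · exact ih

lemma IsRun.rbar_eq {k : ℕ} (hk : k ∈ P.indexK p x rbar) : rbar k = ‖P.r (x k)‖ := by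
  rcases hk with hk | ⟨j, rfl, hj⟩
  · rw [Set.mem_singleton_iff.mp hk, hrun.rbar_zero]
  · rw [hrun.rbar_succ, if_pos hj]

/-- Either the reference value equals the residual and η < 1, or the residual test has just failed
and the reference value was kept. -/
lemma IsRun.mul_rbar_lt_of_pos {k : ℕ} (hk : 0 < rbar k) : p.η * rbar k < ‖P.r (x k)‖ := by
  have hη := p.η_mem.2
  by_cases hK : k ∈ P.indexK p x rbar
  · rw [← hrun.rbar_eq hK]; nlinarith
  · cases k with
    | zero => exact absurd (Or.inl rfl) hK
    | succ j =>
      have hj : ¬ ‖P.r (x (j + 1))‖ ≤ p.η * rbar j := fun h => hK (Or.inr ⟨j, rfl, h⟩)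
      rw [hrun.rbar_succ, if_neg hj]
      exact not_le.mp hj

/-- A rejected step leaves `x` unchanged, so by `mul_rbar_lt_of_pos` it cannot pass the residual
test. A positive index in 𝒦 thus follows an accepted step, which caps ν. -/
lemma IsRun.ν_le_of_mem {k : ℕ} (hk : k ∈ P.indexK p x rbar) (hpos : ∀ j, 0 < rbar j) :
    ν k ≤ p.νbar := by
  rcases hk with hk | ⟨j, rfl, hj⟩
  · rw [Set.mem_singleton_iff.mp hk, hrun.ν_zero]; exact p.ν₀_le
  · refine hrun.ν_succ_le fun h => ?_
    rw [hrun.x_succ, if_pos h] at hj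
    exact (hrun.mul_rbar_lt_of_pos (hpos j)).not_ge hj

lemma IsRun.rbar_eq_zero_of_le {k l : ℕ} (hk : rbar k = 0) (hkl : k ≤ l) : rbar l = 0 := by
  induction l, hkl using Nat.le_induction with
  | base => exact hk
  | succ l _ ih =>
    rw [hrun.rbar_succ, ih, mul_zero]
    split_ifs with h
    · exact le_antisymm h (norm_nonneg _)
    · rfl

variable {xs : E n} {q : ℝ} (hP : P.Standing)
  (hloc : P.LocalAssumption p x (P.indexK p x rbar) xs q)
include hP hloc

/-- If the reference residual vanishes at some iteration, the iterates are eventually constant. -/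
lemma IsRun.eventually_const {k₀ : ℕ} (hk₀ : rbar k₀ = 0) :
    ∀ᶠ k in atTop, x k = xs ∧ P.r (x k) = 0 := by
  obtain ⟨ε, hε, ⟨L, hL, hlip⟩, β, hβ, heb⟩ := hloc.lipschitz_errorBound
  obtain ⟨s, hs, hsK, hsx⟩ := hloc.accum
  have hq : 0 < q := p.δ_mem.1.trans ((le_max_left _ _).trans_lt hloc.q_gt)
  obtain ⟨j, hj, hjk⟩ := ((hsx.eventually (Metric.closedBall_mem_nhds xs (half_pos hε))).and
    (hs.tendsto_atTop.eventually_ge_atTop k₀)).exists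
  rw [dist_eq_norm] at hj
  have hr : P.r (x (s j)) = 0 := by
    rw [← norm_eq_zero, ← hrun.rbar_eq (hsK j)]
    exact hrun.rbar_eq_zero_of_le hk₀ hjk
  have hconst : ∀ k, s j ≤ k → x k = x (s j) := by
    intro k hk
    induction k, hk using Nat.le_induction with
    | base => rfl
    | succ k _ ih =>
      have hun : P.Unsuccessful p (x k) (xhat k) :=
        hP.exists_unsuccessful_of_r_eq_zero hloc.xs_mem hq hε hL hlip hβ heb (hrun.mem_dom hP k)
          (by rw [ih]; exact hj) (by rw [ih]; exact hr)
          (hP.mem_dom_of_inexact (hrun.mem_dom hP k) (hrun.inexact k))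
      rw [hrun.x_succ, if_pos hun, ih]
  have hxs : x (s j) = xs := by
    refine tendsto_nhds_unique (tendsto_const_nhds.congr' ?_) hsx
    filter_upwards [hs.tendsto_atTop.eventually_ge_atTop (s j)] with i hi
    exact (hconst _ hi).symm
  filter_upwards [eventually_ge_atTop (s j)] with k hk
  rw [hconst k hk]
  exact ⟨hxs, hr⟩

lemma IsRun.local_convergence :
    Tendsto x atTop (𝓝 xs) ∧ Tendsto (fun k => ‖P.r (x k)‖) atTop (𝓝 0) ∧
    ∃ C : ℝ, 0 < C ∧ ∀ᶠ k in atTop,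
      ‖P.r (x (k + 1))‖ ≤ C * ‖P.r (x k)‖ ^ min (1 + p.τ) (p.δ + q) ∧
      Metric.infDist (x (k + 1)) P.strongStat
        ≤ C * Metric.infDist (x k) P.strongStat ^ ((1 + p.δ) * q) := by
  have hδ := p.δ_mem.1
  have hq : 0 < q := hδ.trans ((le_max_left _ _).trans_lt hloc.q_gt)
  by_cases hpos : ∀ k, 0 < rbar k
  swap
  · push Not at hpos
    obtain ⟨k₀, hk₀⟩ := hpos
    have hev := hrun.eventually_const hP hloc (le_antisymm hk₀ (hrun.rbar_nonneg k₀))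
    refine ⟨tendsto_const_nhds.congr' (hev.mono fun k hk => hk.1.symm),
      tendsto_const_nhds.congr' (hev.mono fun k hk => by simp only [hk.2, norm_zero]), 1, one_pos, ?_⟩
    filter_upwards [(tendsto_add_atTop_nat 1).eventually hev] with k hk
    rw [hk.2, hk.1, Metric.infDist_zero_of_mem hloc.xs_mem, norm_zero]
    exact ⟨mul_nonneg one_pos.le (Real.rpow_nonneg (norm_nonneg _) _),
      mul_nonneg one_pos.le (Real.rpow_nonneg Metric.infDist_nonneg _)⟩
  obtain ⟨ε, hε, ⟨L, hL, hlip⟩, β, hβ, heb⟩ := hloc.lipschitz_errorBound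
  obtain ⟨s, hs, hsK, hsx⟩ := hloc.accum
  obtain ⟨ε₁, C, K, hε₁, hC, hK, hstep⟩ :=
    hP.exists_local_step (p := p) hloc.xs_mem hloc.q_gt hε hL hlip hβ heb
  have hη0 := p.η_mem.1
  have hη1 := p.η_mem.2
  set t := p.η ^ q with ht
  have ht0 : 0 < t := Real.rpow_pos_of_pos hη0 q
  have ht1 : t < 1 := Real.rpow_lt_one hη0.le hη1 hq
  -- Membership in 𝒦 makes μ equal to ν r^δ with ν ≤ ν̄, as the local step requires, and the local
  -- step returns membership of k + 1.
  have hone : ∀ k, k ∈ P.indexK p x rbar → ‖x k - xs‖ ≤ ε₁ →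
      k + 1 ∈ P.indexK p x rbar ∧ ‖x (k + 1) - x k‖ ≤ C * ‖P.r (x k)‖ ^ q ∧
      ‖P.r (x (k + 1))‖ ≤ p.η * ‖P.r (x k)‖ ∧
      ‖P.r (x (k + 1))‖ ≤ C * ‖P.r (x k)‖ ^ min (1 + p.τ) (p.δ + q) ∧
      Metric.infDist (x (k + 1)) P.strongStat
        ≤ C * Metric.infDist (x k) P.strongStat ^ ((1 + p.δ) * q) := by
    intro k hk hkε
    have hinex := hrun.inexact k
    have hrk := hrun.rbar_eq hk
    rw [hrun.μ_eq, hrk] at hinex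
    obtain ⟨h1, h2, h3, h4, h5⟩ := (hstep (x k) (hrun.mem_dom hP k) hkε).2 (xhat k) (ν k)
      (hrun.νmin_le k) (hrun.ν_le_of_mem hk hpos) (hrk ▸ hpos k) hinex
    have hx : x (k + 1) = xhat k := by rw [hrun.x_succ, if_neg h1]
    rw [← hx] at h2 h3 h4 h5
    exact ⟨Or.inr ⟨k, rfl, by rw [hrk]; exact h4⟩, h2, h4, h3, h5⟩
  have hchain : ∀ ε₂, 0 < ε₂ → ε₂ ≤ ε₁ → ∃ k₀, ∀ k, k₀ ≤ k →
      k ∈ P.indexK p x rbar ∧ ‖x k - xs‖ ≤ ε₂ := by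
    intro ε₂ hε₂ hε₂₁
    have hlim : Tendsto (fun j => C * (K * ‖x (s j) - xs‖) ^ q / (1 - t)) atTop (𝓝 0) := by
      have h1 : Tendsto (fun j => ‖x (s j) - xs‖) atTop (𝓝 0) :=
        tendsto_iff_norm_sub_tendsto_zero.mp hsx
      have h2 := ((h1.const_mul K).rpow_const (p := q) (Or.inr hq.le)).const_mul C
      have h3 := h2.div_const (1 - t)
      rwa [mul_zero, Real.zero_rpow hq.ne', mul_zero, zero_div] at h3
    obtain ⟨j, hj1, hj2⟩ := ((hsx.eventually (Metric.closedBall_mem_nhds xs (half_pos hε₂))).and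
      (hlim.eventually (ge_mem_nhds (half_pos hε₂)))).exists
    rw [dist_eq_norm] at hj1
    have hr₀ := (hstep (x (s j)) (hrun.mem_dom hP _) (by linarith)).1
    set r₀ := ‖P.r (x (s j))‖ with hr₀d
    have hr₀0 : 0 ≤ r₀ := norm_nonneg _
    -- Sum of the geometric series bounding all later steps; it tends to 0 along the subsequence.
    set T := C * r₀ ^ q / (1 - t) with hT
    have ht1' : 0 < 1 - t := by linarith
    have hT0 : 0 ≤ T := div_nonneg (mul_nonneg hC.le (Real.rpow_nonneg hr₀0 q)) ht1'.le
    have hTε : T ≤ ε₂ / 2 := by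
      refine le_trans ?_ hj2
      rw [hT]
      gcongr
    -- T t^i bounds the total length of the steps still to come, and step i uses up at most T(1 -
    -- t)t^i of it.
    have hind : ∀ i, s j + i ∈ P.indexK p x rbar ∧ ‖P.r (x (s j + i))‖ ≤ p.η ^ i * r₀ ∧
        ‖x (s j + i) - xs‖ ≤ ε₂ - T * t ^ i := by
      intro i
      induction i with
      | zero =>
        refine ⟨hsK j, by simp [hr₀d], ?_⟩
        rw [add_zero, pow_zero, mul_one]
        linarith
      | succ i ih =>
        obtain ⟨ih1, ih2, ih3⟩ := ih
        have hTt : 0 ≤ T * t ^ i := mul_nonneg hT0 (pow_nonneg ht0.le i)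
        obtain ⟨h1, h2, h3, -⟩ := hone _ ih1 (by linarith)
        refine ⟨h1, ?_, ?_⟩
        · refine h3.trans ?_
          rw [pow_succ', mul_assoc]
          gcongr
        · have h4 : C * ‖P.r (x (s j + i))‖ ^ q ≤ T * (1 - t) * t ^ i := by
            calc C * ‖P.r (x (s j + i))‖ ^ q ≤ C * (p.η ^ i * r₀) ^ q := by gcongr
              _ = C * (t ^ i * r₀ ^ q) := by
                rw [Real.mul_rpow (pow_nonneg hη0.le i) hr₀0, ← Real.rpow_pow_comm hη0.le]
              _ = _ := by rw [hT, div_mul_cancel₀ _ ht1'.ne']; ring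
          have h5 := norm_sub_le_norm_sub_add_norm_sub (x (s j + (i + 1))) (x (s j + i)) xs
          rw [← add_assoc] at h5 ⊢
          rw [pow_succ]
          linarith
    refine ⟨s j, fun k hk => ?_⟩
    obtain ⟨i, rfl⟩ := Nat.exists_eq_add_of_le hk
    obtain ⟨h1, -, h3⟩ := hind i
    exact ⟨h1, h3.trans (by linarith [mul_nonneg hT0 (pow_nonneg ht0.le i)])⟩
  have hconv : Tendsto x atTop (𝓝 xs) := by
    rw [Metric.tendsto_atTop]
    intro ε' hε'
    obtain ⟨k₀, hk₀⟩ := hchain (min ε₁ (ε' / 2)) (lt_min hε₁ (half_pos hε')) (min_le_left _ _)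
    refine ⟨k₀, fun k hk => ?_⟩
    rw [dist_eq_norm]
    linarith [(hk₀ k hk).2.trans (min_le_right _ _)]
  obtain ⟨k₀, hk₀⟩ := hchain ε₁ hε₁ le_rfl
  refine ⟨hconv, ?_, C, hC, ?_⟩
  · have h1 := (tendsto_iff_norm_sub_tendsto_zero.mp hconv).const_mul K
    rw [mul_zero] at h1
    refine squeeze_zero' (Eventually.of_forall fun k => norm_nonneg _) ?_ h1
    filter_upwards [eventually_ge_atTop k₀] with k hk
    exact (hstep (x k) (hrun.mem_dom hP k) (hk₀ k hk).2).1
  · filter_upwards [eventually_ge_atTop k₀] with k hk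
    exact (hone k (hk₀ k hk).1 (hk₀ k hk).2).2.2.2

end Run

end Problem

end ProxNewton

theorem mainTheorem5 {m n : ℕ} (P : ProxNewton.Problem m n) (hP : P.Standing)
    (p : ProxNewton.Params)
    (x xhat : ℕ → ProxNewton.E n) (ν rbar μ : ℕ → ℝ) (hrun : P.IsRun p x xhat ν rbar μ)
    (xs : ProxNewton.E n) (q : ℝ)
    (hloc : P.LocalAssumption p x (P.indexK p x rbar) xs q)
    (hq : 1 / (1 + p.δ) < q) :
    Filter.Tendsto x Filter.atTop (nhds xs) ∧
    1 < min (1 + p.τ) (p.δ + q) ∧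
    ProxNewton.ConvergesAtRate (fun k => ‖P.r (x k)‖) (min (1 + p.τ) (p.δ + q)) ∧
    1 < (1 + p.δ) * q ∧
    ProxNewton.ConvergesAtRate (fun k => Metric.infDist (x k) P.strongStat) ((1 + p.δ) * q) := by
  have hδ := p.δ_mem.1
  obtain ⟨hconv, hr, C, hC, hev⟩ := hrun.local_convergence hP hloc
  refine ⟨hconv, lt_min (by linarith [p.δ_le_τ]) ?_, ⟨hr, C, hC, hev.mono fun k hk => hk.1⟩, ?_,
    ?_, C, hC, hev.mono fun k hk => hk.2⟩
  · linarith [(le_max_right p.δ (1 - p.δ)).trans_lt hloc.q_gt]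
  -- The extra condition on q enters here: it makes the order for the distance exceed 1.
  · rwa [div_lt_iff₀' (by linarith)] at hq
  · refine squeeze_zero (fun k => Metric.infDist_nonneg)
      (fun k => Metric.infDist_le_dist_of_mem hloc.xs_mem) ?_
    exact tendsto_iff_dist_tendsto_zero.mp hconv
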